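/- Let $M_2\subseteq\mathbb{Z}$ and let $\mathbb{V}(\mathbb{Z},M_2)$ be the infinite strip of height one with marked points $(i,0)$, $i\in\mathbb{Z}$, on its lower boundary and $(u,1)$, $u\in M_2$, on its upper boundary. An arc is a non-contractible simple curve in the strip joining two marked points, up to isotopy fixing the endpoints, and not isotopic to a boundary segment between two consecutive marked points of one boundary (so an arc is determined by its two endpoints). Two arcs are compatible if they have representatives that do not cross except perhaps at endpoints, i.e. if their endpoints do not interlace on the boundary of the strip. A triangulation $T$ is a maximal collection of pairwise compatible arcs. It is admissible if every marked point $(i,0)$ on the lower boundary is incident to only finitely many arcs of $T$. A marked point is special if it is incident to no arc of $T$. A triangle of $T$ is given by three marked points, any two of which are joined by an arc of $T$ or by a boundary segment. An infinite frieze is a map $t:\mathbb{Z}\times\mathbb{Z}\to\mathbb{Z}$ such that $t(i,i)=0$, $t(i,i+1)=1$, $t(i,j)\ge 1$ for $i<j$, $t(i,j)=-t(j,i)$, and $t(i,j)\,t(i+1,j+1)-t(i,j+1)\,t(i+1,j)=1$ for all $i,j$. Its quiddity sequence is $(t(i-1,i+1))_{i\in\mathbb{Z}}$. For marked points $A,B$,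 the number $CC_T(A,B)$ is the label of $B$ produced as follows: label $A$ by $0$, and every marked point joined to $A$ by an arc of $T$ or a boundary segment by $1$; then, whenever a triangle of $T$ has exactly two labelled vertices, label its third vertex by the sum of their labels. Write $CC_T(i,j)$ for $CC_T((i,0),(j,0))$. For integers $i<j$, let $BCI_T(i,i+1,\dots,j)$ be the number of tuples $(\Delta_{i+1},\dots,\Delta_{j-1})$ of pairwise distinct triangles of $T$ such that $(k,0)$ is a vertex of $\Delta_k$ for every $k$ (so it equals $1$ if $j=i+1$), and let $BCI_T(i)=0$ when $i=j$. **Proposition.** Let $T$ be an admissible triangulation of $\mathbb{V}(\mathbb{Z},M_2)$ with no special marked point on the upper boundary, and for each $i\in\mathbb{Z}$ let $a_i$ be the number of triangles of $T$ incident to $(i,0)$. Then there is a unique infinite frieze $t=\Phi(T)$ with quiddity sequence $(a_i)_{i\in\mathbb{Z}}$, and for all integers $i\le j$ the label $CC_T(i,j)$ is well defined (it is reached after finitely many steps and does not depend on the order of the steps), and $$t(i,j)=CC_T(i,j)=BCI_T(i,i+1,\dots,j).$$ -/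

import Mathlib

namespace Strip

/-! ### Marked points and arcs of the infinite strip -/

/-- The marked points of the infinite strip `𝕍(ℤ, M₂)`: the points `(i, 0)` with `i ∈ ℤ` on the lower
boundary and the points `(u, 1)` with `u ∈ M₂` on the upper boundary.

The linear order (`⊕ₗ` is the lexicographic sum, `ᵒᵈ` the reversed order) is the order in which the
marked points are met when the boundary of the strip is traversed counterclockwise: first the lower
boundary from left to right, then the upper boundary from right to left. -/
abbrev MarkedPoint (M₂ : Set ℤ) : Type := ℤ ⊕ₗ (↥M₂)ᵒᵈ

variable {M₂ : Set ℤ}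

/-- The marked point `(i, 0)`. -/
def lower (i : ℤ) : MarkedPoint M₂ := toLex (Sum.inl i)

/-- The marked point `(u, 1)`. -/
def upper (u : M₂) : MarkedPoint M₂ := toLex (Sum.inr (OrderDual.toDual u))

/-- An arc of the strip. The strip is simply connected, so the isotopy class (fixing endpoints) of a
simple curve between two marked points is determined by its two endpoints; we list them in the
boundary order. The endpoints are distinct (a loop is contractible) and the curve is not isotopic to
a boundary segment between consecutive marked points of one boundary: there is a marked point
strictly between the endpoints. (Nothing is excluded for endpoints on different boundaries: between
`(i, 0)` and `(u, 1)` there is always `(i + 1, 0)`.) -/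
@[ext]
structure Arc (M₂ : Set ℤ) where
  fst : MarkedPoint M₂
  snd : MarkedPoint M₂
  lt : fst < snd
  not_boundary : ¬ fst ⋖ snd

/-- The marked point `p` is an endpoint of the arc `α`. -/
def Arc.Incident (α : Arc M₂) (p : MarkedPoint M₂) : Prop := α.fst = p ∨ α.snd = p

/-- Two arcs cross (that is, all their representatives cross in the interior of the strip) iff their
endpoints interlace on the boundary. -/
def Arc.Crosses (α β : Arc M₂) : Prop :=
  (α.fst < β.fst ∧ β.fst < α.snd ∧ α.snd < β.snd) ∨
    (β.fst < α.fst ∧ α.fst < β.snd ∧ β.snd < α.snd)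

/-- Two arcs are compatible if they do not cross, except maybe at their endpoints. -/
def Arc.Compatible (α β : Arc M₂) : Prop := ¬ α.Crosses β

/-! ### Triangulations -/

/-- A triangulation is a maximal collection of pairwise compatible arcs. -/
def IsTriangulation (T : Set (Arc M₂)) : Prop :=
  Maximal (fun S : Set (Arc M₂) => S.Pairwise Arc.Compatible) T

/-- Every marked point on the lower boundary is incident with only finitely many arcs. -/
def IsAdmissible (T : Set (Arc M₂)) : Prop :=
  ∀ i : ℤ, {α ∈ T | α.Incident (lower i)}.Finite

/-- A marked point is special if it is not incident to any arc of the triangulation. -/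
def IsSpecial (T : Set (Arc M₂)) (p : MarkedPoint M₂) : Prop :=
  ¬ ∃ α ∈ T, α.Incident p

/-- The marked points as vertices; two of them are joined if there is an arc of `T` between them or
they are consecutive on one boundary of the strip (`p ⋖ q`: joined by a boundary segment). -/
def edgeGraph (T : Set (Arc M₂)) : SimpleGraph (MarkedPoint M₂) where
  Adj p q := (∃ α ∈ T, (α.fst = p ∧ α.snd = q) ∨ (α.fst = q ∧ α.snd = p)) ∨ p ⋖ q ∨ q ⋖ p
  symm := ⟨by
    rintro p q (⟨α, hα, h⟩ | h | h)
    · exact Or.inl ⟨α, hα, h.symm⟩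
    · exact Or.inr (Or.inr h)
    · exact Or.inr (Or.inl h)⟩
  loopless := ⟨by
    rintro p (⟨α, -, ⟨h, h'⟩ | ⟨h, h'⟩⟩ | h | h)
    · exact absurd α.lt (by simp [h, h'])
    · exact absurd α.lt (by simp [h, h'])
    · exact lt_irrefl _ h.lt
    · exact lt_irrefl _ h.lt⟩

/-- The triangles of the triangulation, given by their sets of three vertices: any two vertices are
joined by an arc of `T` or by a boundary segment. -/
def triangles (T : Set (Arc M₂)) : Set (Finset (MarkedPoint M₂)) :=
  (edgeGraph T).cliqueSet 3

/-- The triangles incident with the marked point `p`. -/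
def trianglesAt (T : Set (Arc M₂)) (p : MarkedPoint M₂) : Set (Finset (MarkedPoint M₂)) :=
  {Δ ∈ triangles T | p ∈ Δ}

/-- The number `a_i` of triangles incident with `(i, 0)`. -/
noncomputable def numTriangles (T : Set (Arc M₂)) (i : ℤ) : ℕ :=
  (trianglesAt T (lower i)).ncard

/-! ### Infinite friezes -/

/-- Infinite friezes, extended antisymmetrically to the whole plane `ℤ × ℤ`. -/
structure IsInfiniteFrieze (t : ℤ → ℤ → ℤ) : Prop where
  diag : ∀ i, t i i = 0
  pos : ∀ i j, i < j → 1 ≤ t i j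
  one : ∀ i, t i (i + 1) = 1
  antisymm : ∀ i j, t i j = - t j i
  unimodular : ∀ i j, t i j * t (i + 1) (j + 1) - t i (j + 1) * t (i + 1) j = 1

/-- The quiddity sequence of an infinite frieze: the diagonal next to the diagonal of ones. -/
def quiddity (t : ℤ → ℤ → ℤ) (i : ℤ) : ℤ := t (i - 1) (i + 1)

/-- `t = Φ(T)`: `t` is an infinite frieze whose quiddity sequence counts the triangles of `T`
incident with each marked point of the lower boundary. -/
def IsPhi (T : Set (Arc M₂)) (t : ℤ → ℤ → ℤ) : Prop :=
  IsInfiniteFrieze t ∧ ∀ i, quiddity t i = numTriangles T i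

/-! ### Conway–Coxeter counting -/

/-- The first stage of the labelling procedure: `A` is labelled zero and every vertex joined to `A`
by an arc or a boundary segment is labelled one; `none` means that there is no label yet. -/
noncomputable def ccInit (T : Set (Arc M₂)) (A : MarkedPoint M₂) :
    MarkedPoint M₂ → Option ℕ :=
  open Classical in
  fun P => if P = A then some 0 else if (edgeGraph T).Adj A P then some 1 else none

/-- One step of the labelling procedure: some triangle `P, Q, R` has exactly two labelled vertices
`P, Q`, and `R` receives the sum of their labels. -/
def CCStep (T : Set (Arc M₂)) (L L' : MarkedPoint M₂ → Option ℕ) : Prop :=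
  ∃ (P Q R : MarkedPoint M₂) (p q : ℕ), {P, Q, R} ∈ triangles T ∧
    L P = some p ∧ L Q = some q ∧ L R = none ∧ L' = Function.update L R (some (p + q))

/-- The labelling procedure started at `A`, with its steps performed in some order, gives the label
`x` to `B` after finitely many steps. -/
def CCLabel (T : Set (Arc M₂)) (A B : MarkedPoint M₂) (x : ℕ) : Prop :=
  ∃ L, Relation.ReflTransGen (CCStep T) (ccInit T A) L ∧ L B = some x

/-- `CC_T(A, B) = n`: the labelling procedure started at `A` reaches `B`, and, in whatever order its
steps are performed, the label that it gives to `B` is `n`. -/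
def CCEq (T : Set (Arc M₂)) (A B : MarkedPoint M₂) (n : ℤ) : Prop :=
  (∃ x : ℕ, CCLabel T A B x) ∧ ∀ x : ℕ, CCLabel T A B x → (x : ℤ) = n

/-! ### Broline–Crowe–Isaacs counting -/

/-- The `r`-tuples for a walk with interior vertices `P 0, …, P (r - 1)`: tuples of pairwise distinct
triangles of the triangulation, the `k`-th of which has `P k` as a vertex. -/
def bciTuples (T : Set (Arc M₂)) {r : ℕ} (P : Fin r → MarkedPoint M₂) :
    Set (Fin r → Finset (MarkedPoint M₂)) :=
  {f | Function.Injective f ∧ ∀ k, f k ∈ trianglesAt T (P k)}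

/-- `BCI_T(i, i + 1, …, j)` for `i ≤ j`: zero if `i = j`, and otherwise the number of tuples for the
walk with interior vertices `(i + 1, 0), …, (j - 1, 0)`; for `j = i + 1` only the empty tuple is
counted, so the value is one. -/
noncomputable def BCI (T : Set (Arc M₂)) (i j : ℤ) : ℕ :=
  if i = j then 0
  else (bciTuples T (fun k : Fin (j - i - 1).toNat => lower (i + 1 + (k : ℤ)))).ncard

end Strip

/-!
Draw the arcs as chords of the boundary, a circularly ordered set; a triangulation is then a maximal
noncrossing graph. Fix a lower point `A`. If, seen from `A`, the vertex `R` of a triangle `P, Q, R`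
lies behind the edge `P, Q`, then the number of `R` is the sum of those of `P` and `Q`, both for the
Conway–Coxeter labels and for the tuples of triangles along the walk from `A`. Summing the
differences over the finite fan of triangles at the point `j` telescopes to
`x (j + 1) + x (j - 1) = a_j x (j)`, the recurrence that every row of a frieze with quiddity
sequence `a` satisfies. Since the labels are positive, the array with these rows is the unique such
frieze.
-/

namespace Strip

/-! ### Circular orders -/

section CircularOrder

variable {α : Type*} [CircularOrder α] {a b c d p x y z : α}

theorem ne_of_sbtw (h : sbtw a b c) : a ≠ b ∧ a ≠ c ∧ b ≠ c := by
  refine ⟨?_, ?_, ?_⟩ <;> rintro rfl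
  exacts [sbtw_irrefl_left h, sbtw_irrefl_left_right h, sbtw_irrefl_right h]

theorem sbtw_trans_tail (habc : sbtw a b c) (hacd : sbtw a c d) : sbtw b c d :=
  (hacd.cyclic_left.trans_right habc.cyclic_right).cyclic_right

theorem sbtw_or_sbtw (hab : a ≠ b) (hac : a ≠ c) (hbc : b ≠ c) : sbtw a b c ∨ sbtw a c b := by
  by_contra! h
  have hcba : btw c b a := btw_iff_not_sbtw.2 h.1
  have habc : btw a b c := (btw_iff_not_sbtw.2 h.2).cyclic_right
  grind [habc.antisymm hcba]

instance isStrictOrder_sbtw (x : α) : IsStrictOrder α (sbtw x) where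
  irrefl _ := sbtw_irrefl_right
  trans _ _ _ hab hbc := hab.trans_right hbc

/-- `y` is the immediate successor of `x` in the circular order. -/
def CircCovBy (x y : α) : Prop := x ≠ y ∧ ∀ r, ¬ sbtw x r y

theorem CircCovBy.sbtw_right (h : CircCovBy x z) (hpx : p ≠ x) (hpz : p ≠ z) : sbtw x z p :=
  (sbtw_or_sbtw h.1 hpx.symm hpz.symm).resolve_right (h.2 p)

theorem CircCovBy.sbtw_left (h : CircCovBy y x) (hpx : p ≠ x) (hpy : p ≠ y) : sbtw x p y :=
  (h.sbtw_right hpy hpx).cyclic_left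

end CircularOrder

attribute [local instance] LinearOrder.toCircularOrder

section LinearOrder

variable {α : Type*} [LinearOrder α] {m x y : α}

theorem sbtw_iff_mem_Ioo (hxy : x < y) : sbtw x m y ↔ m ∈ Set.Ioo x y := by
  refine ⟨?_, Or.inl⟩
  rintro (h | h | h)
  exacts [h, absurd hxy h.2.not_gt, absurd hxy h.1.not_gt]

theorem circCovBy_of_covBy (h : x ⋖ y) : CircCovBy x y :=
  ⟨h.ne, fun _ hr => h.2 ((sbtw_iff_mem_Ioo h.lt).1 hr).1 ((sbtw_iff_mem_Ioo h.lt).1 hr).2⟩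

end LinearOrder

/-! ### Maximal noncrossing graphs -/

/-- A graph on a circularly ordered set of points is maximal noncrossing if no two of its edges,
drawn as chords, cross and every chord that crosses no edge is an edge. In particular the boundary
segments are edges. -/
structure IsMaximalNoncrossing {α : Type*} [CircularOrder α] (G : SimpleGraph α) : Prop where
  noncrossing : ∀ ⦃a b c d⦄, G.Adj a b → G.Adj c d → sbtw a c b → ¬ sbtw b d a
  maximal : ∀ ⦃p q⦄, p ≠ q → (∀ ⦃c d⦄, G.Adj c d → sbtw p c q → ¬ sbtw q d p) → G.Adj p q

namespace IsMaximalNoncrossing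

variable {α : Type*} [CircularOrder α] {G : SimpleGraph α} (hG : IsMaximalNoncrossing G)
  {p p' q q' x y z A P Q R X Z : α}
include hG

theorem adj_of_circCovBy (h : CircCovBy x y) : G.Adj x y :=
  hG.maximal h.1 fun c _ _ hc => absurd hc (h.2 c)

theorem adj_of_consecutive (hp : G.Adj x p) (hq : G.Adj x q) (hpq : sbtw x p q)
    (hc : ∀ r, G.Adj x r → sbtw x p r → ¬ sbtw x r q) : G.Adj p q := by
  refine hG.maximal (ne_of_sbtw hpq).2.2 fun c d hcd hpcq hqdp => ?_
  have hxpc : sbtw x p c := sbtw_trans_tail hpq.cyclic_right hpcq.cyclic_right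
  have hxcq : sbtw x c q := (hpq.cyclic_right.trans_right hpcq.cyclic_right).cyclic_left
  obtain rfl | hdx := eq_or_ne d x
  · exact hc c hcd.symm hxpc hxcq
  · rcases sbtw_or_sbtw hp.ne hdx.symm (ne_of_sbtw hqdp).2.2.symm with hd | hd
    · exact hG.noncrossing hq hcd hxcq (sbtw_trans_tail hqdp.cyclic_right hd.cyclic_left)
    · exact hG.noncrossing hp hcd.symm hd hxpc.cyclic_left

theorem eq_of_adj_right (hq : G.Adj x q) (hq' : G.Adj x q') (h : sbtw x p q) (h' : sbtw x p q')
    (hpq : G.Adj p q) (hpq' : G.Adj p q') : q = q' := by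
  by_contra hne
  rcases sbtw_or_sbtw hq.ne hq'.ne hne with h1 | h1
  · exact hG.noncrossing hq hpq' h h1.cyclic_left
  · exact hG.noncrossing hq' hpq h' h1.cyclic_left

theorem eq_of_adj_left (hp : G.Adj x p) (hp' : G.Adj x p') (h : sbtw x p q) (h' : sbtw x p' q)
    (hpq : G.Adj p q) (hpq' : G.Adj p' q) : p = p' := by
  by_contra hne
  rcases sbtw_or_sbtw hp.ne hp'.ne hne with h1 | h1
  · exact hG.noncrossing hp' hpq h1 h'.cyclic_left
  · exact hG.noncrossing hp hpq' h1 h.cyclic_left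

/-- Seen from `A`, an edge passing behind the vertex `R` of a triangle passes behind the whole
edge opposite to `R`. -/
theorem nested (hPR : G.Adj P R) (hRQ : G.Adj R Q) (hXZ : G.Adj X Z) (hAPR : sbtw A P R)
    (hARQ : sbtw A R Q) (hAXR : sbtw A X R) (hARZ : sbtw A R Z) :
    (X = P ∨ sbtw A X P) ∧ (Z = Q ∨ sbtw A Q Z) := by
  obtain ⟨hAP, -, -⟩ := ne_of_sbtw hAPR
  obtain ⟨-, hAZ, -⟩ := ne_of_sbtw hARZ
  constructor
  · by_contra! h
    have hAPX := (sbtw_or_sbtw hAP (ne_of_sbtw hAXR).1 h.1.symm).resolve_right h.2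
    exact hG.noncrossing hPR hXZ (sbtw_trans_tail hAPX hAXR) (sbtw_trans_tail hAPR hARZ).cyclic_left
  · by_contra! h
    have hAZQ := (sbtw_or_sbtw hAZ (ne_of_sbtw hARQ).2.1 h.1).resolve_right h.2
    exact hG.noncrossing hRQ hXZ.symm (sbtw_trans_tail hARZ hAZQ)
      (sbtw_trans_tail hAXR hARQ).cyclic_right

theorem exists_next (hfin : (G.neighborSet x).Finite) (hp : G.Adj x p) (hz : G.Adj x z)
    (hpz : sbtw x p z) : ∃ q, G.Adj x q ∧ sbtw x p q ∧ G.Adj p q := by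
  have hwf : (G.neighborSet x ∩ {q | sbtw x p q}).WellFoundedOn (sbtw x) :=
    (hfin.inter_of_left _).wellFoundedOn
  obtain ⟨⟨q, hq, hpq⟩, -, hmin⟩ := hwf.has_min Set.univ ⟨⟨z, hz, hpz⟩, trivial⟩
  exact ⟨q, hq, hpq, hG.adj_of_consecutive hp hq hpq fun r hr hpr =>
    hmin ⟨r, hr, hpr⟩ trivial⟩

theorem exists_prev (hfin : (G.neighborSet x).Finite) (hq : G.Adj x q) (hy : G.Adj x y)
    (hyq : sbtw x y q) : ∃ p, G.Adj x p ∧ sbtw x p q ∧ G.Adj p q := by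
  have hwf : (G.neighborSet x ∩ {p | sbtw x p q}).WellFoundedOn (Function.swap (sbtw x)) :=
    (hfin.inter_of_left _).wellFoundedOn
  obtain ⟨⟨p, hp, hpq⟩, -, hmax⟩ := hwf.has_min Set.univ ⟨⟨y, hy, hyq⟩, trivial⟩
  exact ⟨p, hp, hpq, hG.adj_of_consecutive hp hq hpq fun r hr hpr hrq =>
    hmax ⟨r, hr, hrq⟩ trivial hpr⟩

end IsMaximalNoncrossing

/-! ### The fan at a vertex -/

section Triangles

variable {α : Type*} {G : SimpleGraph α} {x : α}

/-- The triangles of a graph at the vertex `x`. -/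
def cliquesAt (G : SimpleGraph α) (x : α) : Set (Finset α) := {Δ ∈ G.cliqueSet 3 | x ∈ Δ}

theorem exists_of_mem_cliquesAt [DecidableEq α] {Δ : Finset α} (hΔ : Δ ∈ cliquesAt G x) :
    ∃ p q, G.Adj x p ∧ G.Adj x q ∧ G.Adj p q ∧ Δ = {x, p, q} := by
  obtain ⟨hΔ, hx⟩ := hΔ
  obtain ⟨a, b, c, hab, hac, hbc, rfl⟩ := SimpleGraph.is3Clique_iff.1 hΔ
  simp only [Finset.mem_insert, Finset.mem_singleton] at hx
  rcases hx with rfl | rfl | rfl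
  · exact ⟨b, c, hab, hac, hbc, rfl⟩
  · exact ⟨a, c, hab.symm, hbc, hac, Finset.insert_comm ..⟩
  · exact ⟨a, b, hac.symm, hbc.symm, hab, by grind⟩

theorem finite_cliquesAt (hfin : (G.neighborSet x).Finite) : (cliquesAt G x).Finite := by
  classical
  refine ((hfin.prod hfin).image fun pq => ({x, pq.1, pq.2} : Finset α)).subset fun Δ hΔ => ?_
  obtain ⟨p, q, hp, hq, -, rfl⟩ := exists_of_mem_cliquesAt hΔ
  exact ⟨(p, q), ⟨hp, hq⟩, rfl⟩

end Triangles

section Fan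

variable {α : Type*} [CircularOrder α] {G : SimpleGraph α} {x y z : α}

/-- The pairs `(p, q)` such that `x`, `p`, `q` are, in this circular order, the vertices of a
triangle of `G`. -/
def fan (G : SimpleGraph α) (x : α) : Set (α × α) :=
  {pq | G.Adj x pq.1 ∧ G.Adj x pq.2 ∧ G.Adj pq.1 pq.2 ∧ sbtw x pq.1 pq.2}

theorem finite_fan (hfin : (G.neighborSet x).Finite) : (fan G x).Finite :=
  (hfin.prod hfin).subset fun _ h => ⟨h.1, h.2.1⟩

theorem bijOn_fan [DecidableEq α] :
    Set.BijOn (fun pq : α × α => ({x, pq.1, pq.2} : Finset α)) (fan G x) (cliquesAt G x) := by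
  refine ⟨?_, ?_, fun Δ hΔ => ?_⟩
  · rintro ⟨p, q⟩ ⟨hp, hq, hpq, -⟩
    exact ⟨SimpleGraph.is3Clique_iff.2 ⟨x, p, q, hp, hq, hpq, rfl⟩, Finset.mem_insert_self ..⟩
  · rintro ⟨p, q⟩ ⟨hp, hq, hpq, hc⟩ ⟨p', q'⟩ ⟨hp', hq', -, hc'⟩ heq
    have hswap : ¬ (p = q' ∧ q = p') := by
      rintro ⟨rfl, rfl⟩
      exact hc.not_sbtw hc'.cyclic_left
    have hmem (r : α) : r = x ∨ r = p ∨ r = q ↔ r = x ∨ r = p' ∨ r = q' := by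
      simpa using Finset.ext_iff.1 heq r
    grind [hmem p, hmem q, hp.ne, hq.ne, hpq.ne]
  · obtain ⟨p, q, hp, hq, hpq, rfl⟩ := exists_of_mem_cliquesAt hΔ
    rcases sbtw_or_sbtw hp.ne hq.ne hpq.ne with hc | hc
    · exact ⟨(p, q), ⟨hp, hq, hpq, hc⟩, rfl⟩
    · exact ⟨(q, p), ⟨hq, hp, hpq.symm, hc⟩, congrArg (insert x) (Finset.pair_comm q p)⟩

theorem ncard_cliquesAt : (cliquesAt G x).ncard = (fan G x).ncard := by
  classical
  rw [← bijOn_fan.image_eq, bijOn_fan.injOn.ncard_image]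

namespace IsMaximalNoncrossing

variable (hG : IsMaximalNoncrossing G) (hfin : (G.neighborSet x).Finite) (hy : CircCovBy y x)
  (hz : CircCovBy x z)
include hG hfin

include hy in
theorem bijOn_fst_fan : Set.BijOn Prod.fst (fan G x) (G.neighborSet x \ {y}) := by
  refine ⟨?_, ?_, fun p ⟨hp, hpy⟩ => ?_⟩
  · rintro ⟨p, q⟩ ⟨hp, -, -, hc⟩
    refine ⟨hp, ?_⟩
    rintro rfl
    exact hy.2 q hc.cyclic_left
  · rintro ⟨p, q⟩ ⟨-, hq, hpq, hc⟩ ⟨p', q'⟩ ⟨-, hq', hpq', hc'⟩ rfl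
    exact Prod.ext rfl (hG.eq_of_adj_right hq hq' hc hc' hpq hpq')
  · obtain ⟨q, hq, hc, hpq⟩ := hG.exists_next hfin hp (hG.adj_of_circCovBy hy).symm
      (hy.sbtw_left hp.ne' hpy)
    exact ⟨(p, q), ⟨hp, hq, hpq, hc⟩, rfl⟩

include hz in
theorem bijOn_snd_fan : Set.BijOn Prod.snd (fan G x) (G.neighborSet x \ {z}) := by
  refine ⟨?_, ?_, fun q ⟨hq, hqz⟩ => ?_⟩
  · rintro ⟨p, q⟩ ⟨-, hq, -, hc⟩
    refine ⟨hq, ?_⟩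
    rintro rfl
    exact hz.2 p hc
  · rintro ⟨p, q⟩ ⟨hp, -, hpq, hc⟩ ⟨p', q'⟩ ⟨hp', -, hpq', hc'⟩ rfl
    exact Prod.ext (hG.eq_of_adj_left hp hp' hc hc' hpq hpq') rfl
  · obtain ⟨p, hp, hc, hpq⟩ := hG.exists_prev hfin hq (hG.adj_of_circCovBy hz)
      (hz.sbtw_right hq.ne' hqz)
    exact ⟨(p, q), ⟨hp, hq, hpq, hc⟩, rfl⟩

include hy hz in
theorem finsum_fan {M : Type*} [AddCommGroup M] (h : α → M) :
    ∑ᶠ pq ∈ fan G x, (h pq.1 - h pq.2) = h z - h y := by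
  have hsum {w : α} (hw : w ∈ G.neighborSet x) {f : α × α → α}
      (hf : Set.BijOn f (fan G x) (G.neighborSet x \ {w})) :
      h w + ∑ᶠ pq ∈ fan G x, h (f pq) = ∑ᶠ p ∈ G.neighborSet x, h p := by
    rw [finsum_mem_eq_of_bijOn f hf fun _ _ => rfl,
      ← finsum_mem_insert h (Set.notMem_sdiff_of_mem (Set.mem_singleton w)) hfin.sdiff,
      Set.insert_sdiff_self_of_mem hw]
  have hsum_fst := hsum (hG.adj_of_circCovBy hy).symm (hG.bijOn_fst_fan hfin hy)
  have hsum_snd := hsum (hG.adj_of_circCovBy hz) (hG.bijOn_snd_fan hfin hz)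
  rw [finsum_mem_sub_distrib _ _ (finite_fan hfin), sub_eq_sub_iff_add_eq_add, add_comm, hsum_fst,
    ← hsum_snd, add_comm]

include hy hz in
theorem finsum_cliquesAt_add [DecidableEq α] {M : Type*} [AddCommGroup M] {w : Finset α → M}
    (h : α → M) {c : M} (hc : ∀ {p q}, (p, q) ∈ fan G x → w {x, p, q} + (h p - h q) = c) :
    ∑ᶠ Δ ∈ cliquesAt G x, w Δ + (h z - h y) = (cliquesAt G x).ncard • c := by
  have hw : ∑ᶠ Δ ∈ cliquesAt G x, w Δ = ∑ᶠ pq ∈ fan G x, w {x, pq.1, pq.2} :=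
    (finsum_mem_eq_of_bijOn _ bijOn_fan fun _ _ => rfl).symm
  rw [hw, ← hG.finsum_fan hfin hy hz h, ← finsum_mem_add_distrib (finite_fan hfin),
    finsum_mem_congr rfl fun pq hpq => hc hpq,
    finsum_mem_eq_finite_toFinset_sum _ (finite_fan hfin), Finset.sum_const, ncard_cliquesAt,
    Set.ncard_eq_toFinset_card _ (finite_fan hfin)]

end IsMaximalNoncrossing
end Fan

/-! ### Conway–Coxeter labels -/

section Labelling

variable {α : Type*} [CircularOrder α] {G : SimpleGraph α} {A P Q R : α} {L : α → Option ℕ}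

/-- The properties of a partial labelling that every stage of the labelling procedure started at
`A` has. The vertices behind an edge, as seen from `A`, are labelled after its endpoints, and the
label of a vertex of a triangle behind the opposite edge is the sum of the other two labels. -/
structure IsLabelling (G : SimpleGraph α) (A : α) (L : α → Option ℕ) : Prop where
  base : L A = some 0
  adj : ∀ ⦃P⦄, G.Adj A P → L P = some 1
  pos : ∀ ⦃P p⦄, P ≠ A → L P = some p → 1 ≤ p
  separating : ∀ ⦃P R Q⦄, G.Adj P Q → sbtw A P R → sbtw A R Q → L R ≠ none →
    L P ≠ none ∧ L Q ≠ none
  sum : ∀ ⦃P R Q r⦄, G.Adj P Q → G.Adj P R → G.Adj R Q → sbtw A P R → sbtw A R Q →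
    L R = some r → ∃ p q, L P = some p ∧ L Q = some q ∧ r = p + q

namespace IsLabelling

variable (hL : IsLabelling G A L)
include hL

theorem sbtw_of_triangle (hPQ : G.Adj P Q) (hPR : G.Adj P R) (hQR : G.Adj Q R) (hP : L P ≠ none)
    (hQ : L Q ≠ none) (hR : L R = none) :
    (sbtw A P R ∧ sbtw A R Q) ∨ (sbtw A Q R ∧ sbtw A R P) := by
  have hRA : A ≠ R := by rintro rfl; simp [hL.base] at hR
  have hPA : A ≠ P := by rintro rfl; simp [hL.adj hPR] at hR
  have hQA : A ≠ Q := by rintro rfl; simp [hL.adj hQR] at hR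
  have hPQR (h : sbtw A P Q) : ¬ sbtw A Q R := fun h' => (hL.separating hPR h h' hQ).2 hR
  have hRPQ (h : sbtw A P Q) : ¬ sbtw A R P := fun h' => (hL.separating hQR.symm h' h hP).1 hR
  have hQPR (h : sbtw A Q P) : ¬ sbtw A P R := fun h' => (hL.separating hQR h h' hP).2 hR
  have hRQP (h : sbtw A Q P) : ¬ sbtw A R Q := fun h' => (hL.separating hPR.symm h' h hQ).1 hR
  have := sbtw_or_sbtw hPA hRA hPR.ne
  have := sbtw_or_sbtw hPA hQA hPQ.ne
  have := sbtw_or_sbtw hQA hRA hQR.ne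
  tauto

variable [DecidableEq α] {X Y Z : α} {p q v y : ℕ} (hG : IsMaximalNoncrossing G)
  (hPR : G.Adj P R) (hRQ : G.Adj R Q) (hAPR : sbtw A P R) (hARQ : sbtw A R Q)
include hG hPR hRQ hAPR hARQ

theorem separating_update (hP : L P ≠ none) (hQ : L Q ≠ none) (hXZ : G.Adj X Z)
    (hXY : sbtw A X Y) (hYZ : sbtw A Y Z) (hY : Function.update L R (some v) Y ≠ none) :
    L X ≠ none ∧ L Z ≠ none := by
  obtain rfl | hYR := eq_or_ne Y R
  · obtain ⟨rfl | hX, rfl | hZ⟩ := hG.nested hPR hRQ hXZ hAPR hARQ hXY hYZ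
    · exact ⟨hP, hQ⟩
    · exact hL.separating hXZ (hXY.trans_right hARQ) hZ hQ
    · exact hL.separating hXZ hX (hAPR.trans_right hYZ) hP
    · exact hL.separating hXZ hX (hAPR.trans_right hYZ) hP
  · exact hL.separating hXZ hXY hYZ (by rwa [Function.update_of_ne hYR] at hY)

theorem sum_update (hPQ : G.Adj P Q) (hP : L P = some p) (hQ : L Q = some q) (hXZ : G.Adj X Z)
    (hXYadj : G.Adj X Y) (hYZadj : G.Adj Y Z) (hXY : sbtw A X Y) (hYZ : sbtw A Y Z)
    (hY : Function.update L R (some (p + q)) Y = some y) :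
    ∃ x z, L X = some x ∧ L Z = some z ∧ y = x + z := by
  obtain rfl | hYR := eq_or_ne Y R
  · have hPX := hG.nested hPR hRQ hXZ hAPR hARQ hXY hYZ
    have hXP := hG.nested hXYadj hYZadj hPQ hXY hYZ hAPR hARQ
    obtain rfl : X = P := hPX.1.elim id fun h => hXP.1.elim Eq.symm fun h' =>
      absurd h'.cyclic_left h.not_sbtw
    obtain rfl : Z = Q := hPX.2.elim id fun h => hXP.2.elim Eq.symm fun h' =>
      absurd h'.cyclic_left h.not_sbtw
    exact ⟨p, q, hP, hQ, by simpa using hY.symm⟩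
  · exact hL.sum hXZ hXYadj hYZadj hXY hYZ (by rwa [Function.update_of_ne hYR] at hY)

theorem update (hPQ : G.Adj P Q) (hP : L P = some p) (hQ : L Q = some q) (hR : L R = none) :
    IsLabelling G A (Function.update L R (some (p + q))) := by
  have hkeep ⦃X x⦄ (hX : L X = some x) : Function.update L R (some (p + q)) X = some x := by
    rw [Function.update_of_ne (by grind), hX]
  have hkeep_ne ⦃X⦄ (hX : L X ≠ none) : Function.update L R (some (p + q)) X ≠ none := by
    obtain ⟨x, hx⟩ := Option.ne_none_iff_exists'.1 hX
    simp [hkeep hx]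
  refine ⟨hkeep hL.base, fun X hX => hkeep (hL.adj hX), fun X x hXA hX => ?_,
    fun X Y Z hXZ hXY hYZ hY => ?_, fun X Y Z y hXZ hXYadj hYZadj hXY hYZ hY => ?_⟩
  · obtain rfl | hXR := eq_or_ne X R
    · have := hL.pos (ne_of_sbtw hAPR).1.symm hP
      grind [Function.update_self]
    · exact hL.pos hXA (by rwa [Function.update_of_ne hXR] at hX)
  · exact (hL.separating_update hG hPR hRQ hAPR hARQ (by simp [hP]) (by simp [hQ]) hXZ hXY
      hYZ hY).imp (@hkeep_ne _) (@hkeep_ne _)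
  · obtain ⟨x, z, hx, hz, hxz⟩ :=
      hL.sum_update hG hPR hRQ hAPR hARQ hPQ hP hQ hXZ hXYadj hYZadj hXY hYZ hY
    exact ⟨x, z, hkeep hx, hkeep hz, hxz⟩

end IsLabelling
end Labelling

section Procedure

variable {M₂ : Set ℤ} {T : Set (Arc M₂)} {A B P Q R x y z : MarkedPoint M₂}
  {L L' : MarkedPoint M₂ → Option ℕ} {m n : ℕ}

theorem mem_triangles_iff : {P, Q, R} ∈ triangles T ↔
    (edgeGraph T).Adj P Q ∧ (edgeGraph T).Adj P R ∧ (edgeGraph T).Adj Q R :=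
  SimpleGraph.is3Clique_triple_iff

theorem ccInit_eq_some_iff :
    ccInit T A B = some n ↔ B = A ∧ n = 0 ∨ (edgeGraph T).Adj A B ∧ n = 1 := by
  have hne : (edgeGraph T).Adj A B → B ≠ A := SimpleGraph.Adj.ne'
  rw [ccInit]
  grind

theorem IsLabelling.eq_some_of_ccInit (hL : IsLabelling (edgeGraph T) A L)
    (h : ccInit T A B = some n) : L B = some n := by
  obtain ⟨rfl, rfl⟩ | ⟨hB, rfl⟩ := ccInit_eq_some_iff.1 h
  exacts [hL.base, hL.adj hB]

theorem isLabelling_ccInit (hG : IsMaximalNoncrossing (edgeGraph T)) :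
    IsLabelling (edgeGraph T) A (ccInit T A) := by
  have hbehind ⦃P R Q⦄ (hPQ : (edgeGraph T).Adj P Q) (hAPR : sbtw A P R) (hARQ : sbtw A R Q) :
      ccInit T A R = none := by
    by_contra! h
    obtain ⟨n, hn⟩ := Option.ne_none_iff_exists'.1 h
    obtain ⟨rfl, -⟩ | ⟨hR, -⟩ := ccInit_eq_some_iff.1 hn
    · exact (ne_of_sbtw hARQ).1 rfl
    · exact hG.noncrossing hR hPQ hAPR hARQ.cyclic_left
  refine ⟨ccInit_eq_some_iff.2 (.inl ⟨rfl, rfl⟩), fun P hP => ccInit_eq_some_iff.2 (.inr ⟨hP, rfl⟩),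
    fun P p hP h => ?_, fun P R Q hPQ hAPR hARQ h => absurd (hbehind hPQ hAPR hARQ) h,
    fun P R Q r hPQ _ _ hAPR hARQ h => ?_⟩
  · obtain ⟨rfl, -⟩ | ⟨-, rfl⟩ := ccInit_eq_some_iff.1 h
    exacts [absurd rfl hP, le_rfl]
  · simp [hbehind hPQ hAPR hARQ] at h

/-- The labelling `L` is a stage of the procedure started at `A`. -/
def Reaches (T : Set (Arc M₂)) (A : MarkedPoint M₂) (L : MarkedPoint M₂ → Option ℕ) : Prop :=
  Relation.ReflTransGen (CCStep T) (ccInit T A) L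

theorem Reaches.isLabelling (hG : IsMaximalNoncrossing (edgeGraph T)) (hL : Reaches T A L) :
    IsLabelling (edgeGraph T) A L := by
  induction hL with
  | refl => exact isLabelling_ccInit hG
  | tail _ hstep ih =>
    obtain ⟨P, Q, R, p, q, hΔ, hP, hQ, hR, rfl⟩ := hstep
    obtain ⟨hPQ, hPR, hQR⟩ := mem_triangles_iff.1 hΔ
    rcases ih.sbtw_of_triangle hPQ hPR hQR (by simp [hP]) (by simp [hQ]) hR with h | h
    · exact ih.update hG hPR hQR.symm h.1 h.2 hPQ hP hQ hR
    · rw [add_comm]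
      exact ih.update hG hQR hPR.symm h.1 h.2 hPQ.symm hQ hP hR

theorem Reaches.eq_of_eq_some (hG : IsMaximalNoncrossing (edgeGraph T)) (hL : Reaches T A L)
    (hL' : Reaches T A L') (hm : L B = some m) (hn : L' B = some n) : m = n := by
  have hI' := hL'.isLabelling hG
  induction hL generalizing B m n with
  | refl => simpa [hI'.eq_some_of_ccInit hm] using hn
  | tail hL₁ hstep ih =>
    obtain ⟨P, Q, R, p, q, hΔ, hP, hQ, hR, rfl⟩ := hstep
    obtain rfl | hBR := eq_or_ne B R
    · obtain rfl : p + q = m := by simpa using hm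
      obtain ⟨hPQ, hPB, hQB⟩ := mem_triangles_iff.1 hΔ
      rcases (Reaches.isLabelling hG hL₁).sbtw_of_triangle hPQ hPB hQB (by simp [hP])
        (by simp [hQ]) hR with h | h
      · obtain ⟨p', q', hp, hq, rfl⟩ := hI'.sum hPQ hPB hQB.symm h.1 h.2 hn
        rw [ih hP hp, ih hQ hq]
      · obtain ⟨q', p', hq, hp, rfl⟩ := hI'.sum hPQ.symm hQB hPB.symm h.1 h.2 hn
        rw [ih hP hp, ih hQ hq, add_comm]
    · exact ih (by rwa [Function.update_of_ne hBR] at hm) hn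

/-- Replay the second run after the first, skipping the steps at vertices already labelled. -/
theorem Reaches.exists_union (hG : IsMaximalNoncrossing (edgeGraph T)) (hL : Reaches T A L)
    (hL' : Reaches T A L') :
    ∃ K, Reaches T A K ∧ ∀ B, L B ≠ none ∨ L' B ≠ none → K B ≠ none := by
  induction hL' with
  | refl =>
    refine ⟨L, hL, fun B hB => hB.elim id fun hB => ?_⟩
    obtain ⟨n, hn⟩ := Option.ne_none_iff_exists'.1 hB
    simp [(hL.isLabelling hG).eq_some_of_ccInit hn]
  | tail _ hstep ih =>
    obtain ⟨K, hK, hdom⟩ := ih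
    obtain ⟨P, Q, R, p, q, hΔ, hP, hQ, -, rfl⟩ := hstep
    by_cases hKR : K R = none
    · obtain ⟨p', hp'⟩ := Option.ne_none_iff_exists'.1 (hdom P (by simp [hP]))
      obtain ⟨q', hq'⟩ := Option.ne_none_iff_exists'.1 (hdom Q (by simp [hQ]))
      refine ⟨_, hK.tail ⟨P, Q, R, p', q', hΔ, hp', hq', hKR, rfl⟩, fun B hB => ?_⟩
      grind [Function.update_apply]
    · exact ⟨K, hK, fun B hB => by grind [Function.update_apply]⟩

/-- The procedure started at `A` eventually labels `B`. -/
def IsLabelled (T : Set (Arc M₂)) (A B : MarkedPoint M₂) : Prop := ∃ n, CCLabel T A B n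

theorem CCLabel.unique (hG : IsMaximalNoncrossing (edgeGraph T)) (hm : CCLabel T A B m)
    (hn : CCLabel T A B n) : m = n := by
  obtain ⟨L, hL, hLm⟩ := hm
  obtain ⟨L', hL', hLn⟩ := hn
  exact Reaches.eq_of_eq_some hG hL hL' hLm hLn

theorem ccLabel_self : CCLabel T A A 0 :=
  ⟨_, .refl, ccInit_eq_some_iff.2 (.inl ⟨rfl, rfl⟩)⟩

theorem ccLabel_of_adj (h : (edgeGraph T).Adj A B) : CCLabel T A B 1 :=
  ⟨_, .refl, ccInit_eq_some_iff.2 (.inr ⟨h, rfl⟩)⟩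

theorem CCLabel.pos (hG : IsMaximalNoncrossing (edgeGraph T)) (hBA : B ≠ A)
    (hn : CCLabel T A B n) : 1 ≤ n := by
  obtain ⟨L, hL, hLn⟩ := hn
  exact (Reaches.isLabelling hG hL).pos hBA hLn

theorem IsLabelled.of_triangle (hG : IsMaximalNoncrossing (edgeGraph T)) (hP : IsLabelled T A P)
    (hQ : IsLabelled T A Q) (hPQ : (edgeGraph T).Adj P Q) (hPR : (edgeGraph T).Adj P R)
    (hQR : (edgeGraph T).Adj Q R) : IsLabelled T A R := by
  obtain ⟨p, L, hL, hp⟩ := hP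
  obtain ⟨q, L', hL', hq⟩ := hQ
  obtain ⟨K, hK, hdom⟩ := Reaches.exists_union hG hL hL'
  obtain ⟨p', hp'⟩ := Option.ne_none_iff_exists'.1 (hdom P (by simp [hp]))
  obtain ⟨q', hq'⟩ := Option.ne_none_iff_exists'.1 (hdom Q (by simp [hq]))
  by_cases hR : K R = none
  · exact ⟨p' + q', _, hK.tail ⟨P, Q, R, p', q', mem_triangles_iff.2 ⟨hPQ, hPR, hQR⟩, hp', hq',
      hR, rfl⟩, by simp⟩
  · obtain ⟨r, hr⟩ := Option.ne_none_iff_exists'.1 hR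
    exact ⟨r, K, hK, hr⟩

/-- The labels spread over the fan at `x`, starting from the predecessor `y` of `x`. -/
theorem IsLabelled.of_adj (hG : IsMaximalNoncrossing (edgeGraph T))
    (hfin : ((edgeGraph T).neighborSet x).Finite) (hyx : CircCovBy y x) (hx : IsLabelled T A x)
    (hy : IsLabelled T A y) (hP : (edgeGraph T).Adj x P) : IsLabelled T A P := by
  have hwf : ((edgeGraph T).neighborSet x).WellFoundedOn (Function.swap (sbtw x)) :=
    hfin.wellFoundedOn
  refine hwf.induction hP fun p (hp : (edgeGraph T).Adj x p) ih => ?_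
  obtain rfl | hpy := eq_or_ne p y
  · exact hy
  obtain ⟨q, hq, hpq, hadj⟩ := hG.exists_next hfin hp (hG.adj_of_circCovBy hyx).symm
    (hyx.sbtw_left hp.ne' hpy)
  exact hx.of_triangle hG (ih q hq hpq) hq hp hadj.symm

open Classical in
/-- The label of `B` in the procedure started at `A` (zero if there is none). -/
noncomputable def label (T : Set (Arc M₂)) (A B : MarkedPoint M₂) : ℕ :=
  if h : IsLabelled T A B then h.choose else 0

theorem IsLabelled.ccLabel (h : IsLabelled T A B) : CCLabel T A B (label T A B) := by
  rw [label, dif_pos h]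
  exact h.choose_spec

theorem CCLabel.label_eq (hG : IsMaximalNoncrossing (edgeGraph T)) (hn : CCLabel T A B n) :
    label T A B = n :=
  (IsLabelled.ccLabel ⟨n, hn⟩).unique hG hn

theorem IsLabelled.ccEq (hG : IsMaximalNoncrossing (edgeGraph T)) (h : IsLabelled T A B) :
    CCEq T A B (label T A B) :=
  ⟨h, fun _ hn => congrArg _ (CCLabel.label_eq hG hn).symm⟩

theorem label_add (hG : IsMaximalNoncrossing (edgeGraph T)) (hPQ : (edgeGraph T).Adj P Q)
    (hPR : (edgeGraph T).Adj P R) (hRQ : (edgeGraph T).Adj R Q) (hAPR : sbtw A P R)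
    (hARQ : sbtw A R Q) (hR : IsLabelled T A R) :
    label T A P + label T A Q = label T A R := by
  obtain ⟨r, L, hL, hr⟩ := hR
  obtain ⟨p, q, hp, hq, rfl⟩ := (Reaches.isLabelling hG hL).sum hPQ hPR hRQ hAPR hARQ hr
  rw [CCLabel.label_eq hG ⟨L, hL, hr⟩, CCLabel.label_eq hG ⟨L, hL, hp⟩,
    CCLabel.label_eq hG ⟨L, hL, hq⟩]

open Classical in
/-- The label of `p` with a sign telling on which side of the chord from `A` to `x` it lies. The
difference of two consecutive neighbours of `x` is the label of `x`, so this function telescopes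
over the fan at `x`. -/
noncomputable def signedLabel (T : Set (Arc M₂)) (A x p : MarkedPoint M₂) : ℤ :=
  if sbtw A x p then label T A p else - label T A p

theorem signedLabel_of_sbtw (h : sbtw A x P) : signedLabel T A x P = label T A P := if_pos h

theorem signedLabel_of_not_sbtw (h : ¬ sbtw A x P) : signedLabel T A x P = - label T A P :=
  if_neg h

theorem signedLabel_sub_signedLabel (hG : IsMaximalNoncrossing (edgeGraph T)) (hxA : x ≠ A)
    (hx : IsLabelled T A x) (hP : IsLabelled T A P) (hQ : IsLabelled T A Q)
    (hPQ : (P, Q) ∈ fan (edgeGraph T) x) :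
    signedLabel T A x P - signedLabel T A x Q = label T A x := by
  obtain ⟨hxP, hxQ, hPQ, hc⟩ := hPQ
  have hA : label T A A = 0 := ccLabel_self.label_eq hG
  have hone {B} (h : (edgeGraph T).Adj A B) : label T A B = 1 := (ccLabel_of_adj h).label_eq hG
  have hswap {a b c : MarkedPoint M₂} (h : sbtw a b c) : ¬ sbtw a c b := fun h' =>
    h.not_sbtw h'.cyclic_left
  obtain rfl | hPA := eq_or_ne P A
  · rw [signedLabel_of_not_sbtw sbtw_irrefl_left_right,
      signedLabel_of_not_sbtw (hswap hc.cyclic_left), hA, hone hPQ, hone hxP.symm]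
    rfl
  obtain rfl | hQA := eq_or_ne Q A
  · rw [signedLabel_of_sbtw hc.cyclic_right, signedLabel_of_not_sbtw sbtw_irrefl_left_right, hA,
      hone hPQ.symm, hone hxQ.symm]
    rfl
  rcases sbtw_or_sbtw hxA.symm hPA.symm hxP.ne with hAxP | hAPx
  · rw [signedLabel_of_sbtw hAxP]
    rcases sbtw_or_sbtw hxA.symm hQA.symm hxQ.ne with hAxQ | hAQx
    · have hAPQ : sbtw A P Q := (sbtw_trans_tail hc hAxQ.cyclic_left).cyclic_right
      rw [signedLabel_of_sbtw hAxQ, ← label_add hG hxQ hxP hPQ hAxP hAPQ hP]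
      push_cast
      ring
    · rw [signedLabel_of_not_sbtw (hswap hAQx), ← label_add hG hPQ.symm hxQ.symm hxP hAQx hAxP hx]
      push_cast
      ring
  · have hAQx : sbtw A Q x := (hAPx.cyclic_right.trans_right hc).cyclic_left
    have hAPQ : sbtw A P Q := sbtw_trans_tail hAPx.cyclic_right hc
    rw [signedLabel_of_not_sbtw (hswap hAPx), signedLabel_of_not_sbtw (hswap hAQx),
      ← label_add hG hxP.symm hPQ hxQ.symm hAPQ hAQx hQ]
    push_cast
    ring

theorem label_add_label (hG : IsMaximalNoncrossing (edgeGraph T))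
    (hfin : ((edgeGraph T).neighborSet x).Finite) (hyx : CircCovBy y x) (hxz : CircCovBy x z)
    (hxA : x ≠ A) (hx : IsLabelled T A x) (hy : IsLabelled T A y) :
    (label T A z + label T A y : ℤ) = (cliquesAt (edgeGraph T) x).ncard * label T A x := by
  have hA : label T A A = 0 := ccLabel_self.label_eq hG
  have hnbr {p} (hp : (edgeGraph T).Adj x p) : IsLabelled T A p := hx.of_adj hG hfin hyx hy hp
  have hz : signedLabel T A x z = label T A z := by
    obtain rfl | hzA := eq_or_ne z A
    · simp [signedLabel, hA]
    · exact signedLabel_of_sbtw (hxz.sbtw_right hxA.symm hzA.symm).cyclic_right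
  have hy' : signedLabel T A x y = - label T A y :=
    signedLabel_of_not_sbtw fun h => hyx.2 A h.cyclic_right
  rw [← nsmul_eq_mul, ← hG.finsum_cliquesAt_add hfin hyx hxz (w := 0) (signedLabel T A x) fun hpq =>
    (zero_add _).trans (signedLabel_sub_signedLabel hG hxA hx (hnbr hpq.1) (hnbr hpq.2.1) hpq), hz,
    hy', sub_neg_eq_add]
  simp

end Procedure

/-! ### Systems of distinct representatives -/

section DistinctReps

variable {ι β : Type*} [Inhabited β] {S : ι → Set β} {I J : Set ι} {i : ι} {f g : ι → β}

/-- The systems of distinct representatives of the sets `S i`, `i ∈ I`. They take the value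
`default` outside of `I`, so that each system is a single function. -/
def distinctReps (S : ι → Set β) (I : Set ι) : Set (ι → β) :=
  {f | Set.InjOn f I ∧ (∀ i ∈ I, f i ∈ S i) ∧ ∀ i ∉ I, f i = default}

theorem distinctReps_empty : distinctReps S ∅ = {default} := by
  ext f
  simp [distinctReps, funext_iff]

theorem exists_distinctReps_singleton {b : β} (hS : S i = {b}) :
    ∃ e, distinctReps S {i} = {e} ∧ e '' {i} = {b} := by
  classical
  refine ⟨Function.update default i b, Set.eq_singleton_iff_unique_mem.2 ⟨?_, ?_⟩, by simp⟩
  · refine ⟨Set.injOn_singleton _ _, by simp [hS], fun j hj => ?_⟩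
    exact Function.update_of_ne hj _ _
  · rintro f ⟨-, hmem, hdef⟩
    have hi : f i ∈ ({b} : Set β) := hS ▸ hmem i rfl
    exact Function.eq_update_iff.2 ⟨hi, hdef⟩

theorem distinctReps_congr {S' : ι → Set β} (h : ∀ i ∈ I, S i = S' i) :
    distinctReps S I = distinctReps S' I := by
  ext f
  exact and_congr_right fun _ => and_congr_left fun _ => forall₂_congr fun i hi => by rw [h i hi]

theorem finite_distinctReps (hI : I.Finite) (hS : ∀ i ∈ I, (S i).Finite) :
    (distinctReps S I).Finite := by
  classical
  have := hI.to_subtype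
  refine ((Set.Finite.pi' fun i : I => hS i i.2).image
    fun f j => if h : j ∈ I then f ⟨j, h⟩ else default).subset fun f hf => ?_
  exact ⟨fun i => f i, fun i => hf.2.1 i i.2, funext fun j => by grind [hf.2.2 j]⟩

theorem piecewise_mem_distinctReps [∀ i, Decidable (i ∈ J)] (hf : f ∈ distinctReps S I)
    (hJI : J ⊆ I) : J.piecewise f (fun _ => default) ∈ distinctReps S J := by
  refine ⟨(hf.1.mono hJI).congr (Set.piecewise_eqOn J f _).symm, fun i hi => ?_,
    fun i hi => ?_⟩
  · rw [Set.piecewise_eq_of_mem _ _ _ hi]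
    exact hf.2.1 i (hJI hi)
  · exact Set.piecewise_eq_of_notMem _ _ _ hi

theorem bijOn_comp_distinctReps {κ : Type*} {P : κ → ι} (hP : Function.Injective P) :
    Set.BijOn (· ∘ P) (distinctReps S (Set.range P))
      {f | Function.Injective f ∧ ∀ k, f k ∈ S (P k)} := by
  refine ⟨fun f hf => ⟨?_, fun k => hf.2.1 _ ⟨k, rfl⟩⟩, fun f hf g hg hfg => ?_,
    fun g hg => ⟨Function.extend P g default, ⟨?_, ?_, ?_⟩, Function.extend_comp hP _ _⟩⟩
  · exact fun k l hkl => hP (hf.1 ⟨k, rfl⟩ ⟨l, rfl⟩ hkl)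
  · ext1 i
    by_cases hi : i ∈ Set.range P
    · obtain ⟨k, rfl⟩ := hi
      exact congrFun hfg k
    · rw [hf.2.2 i hi, hg.2.2 i hi]
  · rintro _ ⟨k, rfl⟩ _ ⟨l, rfl⟩ hkl
    rw [hP.extend_apply, hP.extend_apply] at hkl
    rw [hg.1 hkl]
  · rintro _ ⟨k, rfl⟩
    rw [hP.extend_apply]
    exact hg.2 k
  · exact fun i hi => Function.extend_apply' _ _ _ hi

theorem distinctReps_insert [DecidableEq ι] (hi : i ∉ I) :
    distinctReps S (insert i I) =
      ⋃ b ∈ S i, (Function.update · i b) '' distinctReps (fun j => S j \ {b}) I := by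
  ext f
  simp only [Set.mem_iUnion₂, Set.mem_image]
  constructor
  · rintro ⟨hinj, hmem, hdef⟩
    rw [Set.injOn_insert hi] at hinj
    refine ⟨f i, hmem i (Set.mem_insert i I), Function.update f i default, ⟨?_, ?_, ?_⟩, by simp⟩
    · exact hinj.1.congr fun j hj => by grind
    all_goals grind
  · rintro ⟨b, hb, f, ⟨hinj, hmem, hdef⟩, rfl⟩
    refine ⟨(Set.injOn_insert hi).2 ⟨hinj.congr fun j hj => by grind, ?_⟩, ?_, ?_⟩
    all_goals grind

theorem ncard_distinctReps_insert (hi : i ∉ I) (hI : I.Finite)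
    (hS : ∀ j ∈ insert i I, (S j).Finite) :
    (distinctReps S (insert i I)).ncard =
      ∑ᶠ b ∈ S i, (distinctReps (fun j => S j \ {b}) I).ncard := by
  classical
  have hfin (b : β) : (distinctReps (fun j => S j \ {b}) I).Finite :=
    finite_distinctReps hI fun j hj => (hS j (Set.mem_insert_of_mem i hj)).sdiff
  rw [distinctReps_insert hi, Set.Finite.ncard_biUnion (hS i (Set.mem_insert i I))
    fun b _ => (hfin b).image _]
  · refine finsum_mem_congr rfl fun b _ => Set.InjOn.ncard_image fun f hf g hg hfg => ?_
    funext j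
    have := congrFun hfg j
    grind [hf.2.2 i hi, hg.2.2 i hi]
  · rintro b - c - hbc
    rw [Function.onFun, Set.disjoint_left]
    rintro _ ⟨f, -, rfl⟩ ⟨g, -, hgf⟩
    exact hbc (by simpa using (congrFun hgf i).symm)

/-- Split according to whether `b`, which only `S i` contains, represents `S i`. -/
theorem ncard_distinctReps_insert_eq_add (hi : i ∉ I) (hI : I.Finite)
    (hS : ∀ j ∈ insert i I, (S j).Finite) {b : β} (hb : b ∈ S i) (hbI : ∀ j ∈ I, b ∉ S j) :
    (distinctReps S (insert i I)).ncard =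
      (distinctReps (fun j => S j \ {b}) (insert i I)).ncard + (distinctReps S I).ncard := by
  have hSb : ∀ j ∈ I, S j = S j \ {b} := fun j hj =>
    (Set.sdiff_singleton_eq_self (hbI j hj)).symm
  have hSbc (c : β) : distinctReps (fun j => S j \ {c}) I =
      distinctReps (fun j => (S j \ {b}) \ {c}) I :=
    distinctReps_congr fun j hj => congrArg (· \ {c}) (hSb j hj)
  rw [ncard_distinctReps_insert hi hI hS,
    ncard_distinctReps_insert hi hI fun j hj => (hS j hj).sdiff, distinctReps_congr hSb]
  simp only [← hSbc]
  conv_lhs => rw [← Set.insert_sdiff_self_of_mem hb]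
  rw [finsum_mem_insert _ (Set.notMem_sdiff_of_mem (Set.mem_singleton b))
    (hS i (Set.mem_insert i I)).sdiff, add_comm]

variable (hJ : distinctReps S J = {g})
include hJ

theorem eqOn_of_distinctReps_eq_singleton (hf : f ∈ distinctReps S I) (hJI : J ⊆ I) :
    Set.EqOn f g J := by
  classical
  have hfg : J.piecewise f (fun _ => default) = g := hJ.subset (piecewise_mem_distinctReps hf hJI)
  exact hfg ▸ (Set.piecewise_eqOn J f _).symm

theorem distinctReps_sdiff_eq_singleton {F : Set β} (hF : Disjoint F (g '' J)) :
    distinctReps (fun j => S j \ F) J = {g} := by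
  have hg : g ∈ distinctReps S J := hJ.superset rfl
  refine Set.eq_singleton_iff_unique_mem.2 ⟨⟨hg.1, fun j hj => ⟨hg.2.1 j hj, fun hF' => ?_⟩,
    hg.2.2⟩, fun f hf => hJ.subset ⟨hf.1, fun j hj => (hf.2.1 j hj).1, hf.2.2⟩⟩
  exact Set.disjoint_left.1 hF hF' (Set.mem_image_of_mem g hj)

theorem distinctReps_sdiff_eq_empty {F : Set β} (hF : ¬ Disjoint F (g '' J)) (hJI : J ⊆ I) :
    distinctReps (fun j => S j \ F) I = ∅ := by
  refine Set.eq_empty_of_forall_notMem fun f hf => ?_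
  have hfg := eqOn_of_distinctReps_eq_singleton hJ
    ⟨hf.1, fun j hj => (hf.2.1 j hj).1, hf.2.2⟩ hJI
  refine hF (Set.disjoint_right.2 ?_)
  rintro _ ⟨j, hj, rfl⟩
  exact hfg hj ▸ (hf.2.1 j (hJI hj)).2

theorem piecewise_mem_distinctReps_union [∀ i, Decidable (i ∈ J)] (hIJ : Disjoint I J)
    (hf : f ∈ distinctReps (fun i => S i \ g '' J) I) :
    J.piecewise g f ∈ distinctReps S (I ∪ J) := by
  have hg : g ∈ distinctReps S J := hJ.superset rfl
  have hI {i : ι} (hi : i ∈ I) : J.piecewise g f i = f i :=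
    Set.piecewise_eq_of_notMem _ _ _ (Set.disjoint_left.1 hIJ hi)
  have hJ' {j : ι} (hj : j ∈ J) : J.piecewise g f j = g j := Set.piecewise_eq_of_mem _ _ _ hj
  refine ⟨(Set.injOn_union hIJ).2 ⟨hf.1.congr fun i hi => (hI hi).symm,
    hg.1.congr fun j hj => (hJ' hj).symm, fun i hi j hj => ?_⟩, ?_, fun i hi => ?_⟩
  · rw [hI hi, hJ' hj]
    exact fun h => (hf.2.1 i hi).2 (h ▸ Set.mem_image_of_mem g hj)
  · rintro i (hi | hi)
    · exact hI hi ▸ (hf.2.1 i hi).1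
    · exact hJ' hi ▸ hg.2.1 i hi
  · rw [Set.mem_union, not_or] at hi
    rw [Set.piecewise_eq_of_notMem _ _ _ hi.2, hf.2.2 i hi.1]

theorem piecewise_mem_distinctReps_sdiff [∀ i, Decidable (i ∈ I)] (hIJ : Disjoint I J)
    (hf : f ∈ distinctReps S (I ∪ J)) :
    I.piecewise f (fun _ => default) ∈ distinctReps (fun i => S i \ g '' J) I := by
  have hI := piecewise_mem_distinctReps hf Set.subset_union_left
  refine ⟨hI.1, fun i hi => ⟨hI.2.1 i hi, ?_⟩, hI.2.2⟩
  rw [Set.piecewise_eq_of_mem _ _ _ hi]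
  rintro ⟨j, hj, hji⟩
  rw [← eqOn_of_distinctReps_eq_singleton hJ hf Set.subset_union_right hj] at hji
  exact Set.disjoint_left.1 hIJ hi (hf.1 (Or.inr hj) (Or.inl hi) hji ▸ hj)

theorem bijOn_piecewise_distinctReps [∀ i, Decidable (i ∈ J)] (hIJ : Disjoint I J) :
    Set.BijOn (fun f => J.piecewise g f) (distinctReps (fun i => S i \ g '' J) I)
      (distinctReps S (I ∪ J)) := by
  classical
  refine Set.InvOn.bijOn (f' := fun f => I.piecewise f (fun _ => default))
    ⟨fun f hf => funext fun i => ?_, fun f hf => funext fun i => ?_⟩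
    (fun f hf => piecewise_mem_distinctReps_union hJ hIJ hf)
    fun f hf => piecewise_mem_distinctReps_sdiff hJ hIJ hf
  · have hi : i ∈ I → i ∉ J := fun h => Set.disjoint_left.1 hIJ h
    have hdef := hf.2.2 i
    grind [Set.piecewise]
  · have hi : i ∈ J → f i = g i := fun h =>
      eqOn_of_distinctReps_eq_singleton hJ hf Set.subset_union_right h
    have hdef := hf.2.2 i
    grind [Set.piecewise]

theorem ncard_distinctReps_union (hIJ : Disjoint I J) :
    (distinctReps S (I ∪ J)).ncard = (distinctReps (fun i => S i \ g '' J) I).ncard := by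
  classical
  have hbij := bijOn_piecewise_distinctReps hJ hIJ
  rw [← hbij.image_eq, hbij.injOn.ncard_image]

theorem exists_distinctReps_union_eq_singleton (hIJ : Disjoint I J)
    (hI : distinctReps (fun i => S i \ g '' J) I = {f}) :
    ∃ e, distinctReps S (I ∪ J) = {e} ∧ e '' (I ∪ J) = f '' I ∪ g '' J := by
  classical
  refine ⟨J.piecewise g f, ?_, ?_⟩
  · rw [← (bijOn_piecewise_distinctReps hJ hIJ).image_eq, hI, Set.image_singleton]
  · rw [Set.image_union, (Set.piecewise_eqOn J g f).image_eq,
      ((Set.piecewise_eqOn_compl J g f).mono hIJ.subset_compl_right).image_eq]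

end DistinctReps

/-! ### Tuples of triangles along a walk -/

section Walk

variable {α : Type*} [LinearOrder α] {G : SimpleGraph α} {a b c d x y z m A : α} {Δ : Finset α}

/-- The triangles all of whose vertices lie between `x` and `y`. -/
def trianglesIn (G : SimpleGraph α) (x y : α) : Set (Finset α) :=
  {Δ ∈ G.cliqueSet 3 | ∀ p ∈ Δ, p ∈ Set.Icc x y}

theorem trianglesIn_eq_empty (hxy : Set.Ioo x y = ∅) : trianglesIn G x y = ∅ := by
  refine Set.eq_empty_of_forall_notMem fun Δ hΔ => ?_
  have hs : Δ ⊆ {x, y} := fun p hp => by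
    have hpxy : p ∉ Set.Ioo x y := hxy ▸ Set.notMem_empty p
    grind [hΔ.2 p hp]
  have hcard := Finset.card_le_card hs
  rw [hΔ.1.card_eq] at hcard
  exact absurd (hcard.trans Finset.card_le_two) (by norm_num)

theorem disjoint_trianglesIn : Disjoint (trianglesIn G x y) (trianglesIn G y z) := by
  refine Set.disjoint_left.2 fun Δ hxy hyz => ?_
  have hs : Δ ⊆ {y} := fun p hp =>
    Finset.mem_singleton.2 (le_antisymm (hxy.2 p hp).2 (hyz.2 p hp).1)
  have hcard := Finset.card_le_card hs
  rw [hxy.1.card_eq, Finset.card_singleton] at hcard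
  exact absurd hcard (by norm_num)

namespace IsMaximalNoncrossing

variable (hG : IsMaximalNoncrossing G)
include hG

theorem not_lt_of_adj (hab : G.Adj a b) (hcd : G.Adj c d) (hac : a < c) (hcb : c < b) : ¬ b < d :=
  fun hbd => hG.noncrossing hab hcd (Or.inl ⟨hac, hcb⟩)
    (Or.inr (Or.inr ⟨hac.trans hcb, hbd⟩))

theorem mem_trianglesIn (hxy : G.Adj x y) (hz : z ∈ Set.Ioo x y) (hΔ : Δ ∈ cliquesAt G z) :
    Δ ∈ trianglesIn G x y := by
  refine ⟨hΔ.1, fun p hp => ?_⟩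
  obtain rfl | hpz := eq_or_ne p z
  · exact Set.Ioo_subset_Icc_self hz
  have hzp : G.Adj z p := hΔ.1.isClique hΔ.2 hp hpz.symm
  exact ⟨le_of_not_gt fun hpx => hG.not_lt_of_adj hzp.symm hxy hpx hz.1 hz.2,
    le_of_not_gt fun hyp => hG.not_lt_of_adj hxy hzp hz.1 hz.2 hyp⟩

theorem trianglesIn_subset (hxm : G.Adj x m) (hmy : G.Adj m y) (hm : m ∈ Set.Ioo x y) :
    trianglesIn G x y ⊆ insert {x, m, y} (trianglesIn G x m ∪ trianglesIn G m y) := by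
  rintro Δ ⟨hΔ, hmem⟩
  have hends {p q : α} (hp : p ∈ Δ) (hq : q ∈ Δ) (hpm : p < m) (hmq : m < q) : p = x ∧ q = y := by
    have hpq : G.Adj p q := hΔ.isClique hp hq (hpm.trans hmq).ne
    have hxp := (hmem p hp).1
    have hqy := (hmem q hq).2
    exact ⟨by_contra fun hne => hG.not_lt_of_adj hxm hpq (lt_of_le_of_ne' hxp hne) hpm hmq,
      by_contra fun hne => hG.not_lt_of_adj hpq hmy hpm hmq (lt_of_le_of_ne hqy hne)⟩
  by_cases hle : ∀ q ∈ Δ, q ≤ m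
  · exact Or.inr (Or.inl ⟨hΔ, fun p hp => ⟨(hmem p hp).1, hle p hp⟩⟩)
  by_cases hge : ∀ p ∈ Δ, m ≤ p
  · exact Or.inr (Or.inr ⟨hΔ, fun p hp => ⟨hge p hp, (hmem p hp).2⟩⟩)
  push Not at hle hge
  obtain ⟨q, hq, hmq⟩ := hle
  obtain ⟨p, hp, hpm⟩ := hge
  refine Or.inl (Finset.eq_of_subset_of_card_le (fun r hr => ?_)
    (hΔ.card_eq.symm ▸ Finset.card_le_three))
  rcases lt_trichotomy r m with hrm | rfl | hmr
  · simp [hends hr hq hrm hmq]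
  · simp
  · simp [hends hp hr hpm hmr]

theorem trianglesIn_eq_insert (hxm : G.Adj x m) (hmy : G.Adj m y) (hxy : G.Adj x y)
    (hm : m ∈ Set.Ioo x y) :
    trianglesIn G x y = insert {x, m, y} (trianglesIn G x m ∪ trianglesIn G m y) := by
  refine (hG.trianglesIn_subset hxm hmy hm).antisymm (Set.insert_subset ?_ (Set.union_subset ?_ ?_))
  · refine ⟨SimpleGraph.is3Clique_triple_iff.2 ⟨hxm, hxy, hmy⟩, fun p hp => ?_⟩
    have hlt := hm.1.trans hm.2
    grind
  · exact fun Δ hΔ => ⟨hΔ.1, fun p hp => Set.Icc_subset_Icc_right hm.2.le (hΔ.2 p hp)⟩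
  · exact fun Δ hΔ => ⟨hΔ.1, fun p hp => Set.Icc_subset_Icc_left hm.1.le (hΔ.2 p hp)⟩

theorem exists_adj_adj (hxy : G.Adj x y) (hfin : (Set.Ioo x y).Finite)
    (hne : (Set.Ioo x y).Nonempty) : ∃ m ∈ Set.Ioo x y, G.Adj x m ∧ G.Adj m y := by
  obtain ⟨s, hs, hmin⟩ := Set.exists_min_image _ id hfin hne
  have hxs : G.Adj x s := hG.adj_of_circCovBy ⟨hs.1.ne, fun r hr => by
    have hr' := (sbtw_iff_mem_Ioo hs.1).1 hr
    exact (hmin r ⟨hr'.1, hr'.2.trans hs.2⟩).not_gt hr'.2⟩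
  obtain ⟨m, ⟨hm, hxm⟩, hmax⟩ := Set.exists_max_image (Set.Ioo x y ∩ G.neighborSet x) id
    (hfin.inter_of_left _) ⟨s, hs, hxs⟩
  refine ⟨m, hm, hxm, hG.adj_of_consecutive hxm hxy (Or.inl hm) fun r hxr hmr hry => ?_⟩
  have hr := (sbtw_iff_mem_Ioo (hm.1.trans hm.2)).1 hry
  exact (hmax r ⟨hr, hxr⟩).not_gt ((sbtw_iff_mem_Ioo hr.1).1 hmr).2

theorem cliquesAt_sdiff_eq_singleton (hxm : G.Adj x m) (hmy : G.Adj m y) (hxy : G.Adj x y)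
    (hm : m ∈ Set.Ioo x y) :
    cliquesAt G m \ (trianglesIn G x m ∪ trianglesIn G m y) = {{x, m, y}} := by
  refine Set.eq_singleton_iff_unique_mem.2 ⟨⟨⟨?_, by simp⟩, ?_⟩, fun Δ hΔ => ?_⟩
  · exact SimpleGraph.is3Clique_triple_iff.2 ⟨hxm, hxy, hmy⟩
  · rintro (h | h)
    · exact (h.2 y (by simp)).2.not_gt hm.2
    · exact (h.2 x (by simp)).1.not_gt hm.1
  · have hmem := hG.mem_trianglesIn hxy hm hΔ.1
    rw [hG.trianglesIn_eq_insert hxm hmy hxy hm] at hmem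
    exact hmem.resolve_right hΔ.2

/-- Every triangle at a vertex strictly under an edge lies under the edge, and the triangle on the
edge splits the triangles under it into two groups of the same kind; so the representatives are
forced. -/
theorem exists_distinctReps_eq_singleton (hxy : G.Adj x y) (hfin : (Set.Ioo x y).Finite) :
    ∃ g, distinctReps (cliquesAt G) (Set.Ioo x y) = {g} ∧
      g '' Set.Ioo x y = trianglesIn G x y := by
  induction hn : (Set.Ioo x y).ncard using Nat.strong_induction_on generalizing x y with
  | _ n ih =>
  subst hn
  obtain hempty | hne := (Set.Ioo x y).eq_empty_or_nonempty
  · refine ⟨default, ?_, ?_⟩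
    · rw [hempty, distinctReps_empty]
    · rw [trianglesIn_eq_empty hempty, hempty, Set.image_empty]
  obtain ⟨m, hm, hxm, hmy⟩ := hG.exists_adj_adj hxy hfin hne
  have hleft : Set.Ioo x m ⊂ Set.Ioo x y :=
    ⟨Set.Ioo_subset_Ioo_right hm.2.le, fun h => (h hm).2.false⟩
  have hright : Set.Ioo m y ⊂ Set.Ioo x y :=
    ⟨Set.Ioo_subset_Ioo_left hm.1.le, fun h => (h hm).1.false⟩
  obtain ⟨g₁, hg₁, himage₁⟩ := ih _ (Set.ncard_lt_ncard hleft hfin) hxm (hfin.subset hleft.1) rfl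
  obtain ⟨g₂, hg₂, himage₂⟩ := ih _ (Set.ncard_lt_ncard hright hfin) hmy (hfin.subset hright.1) rfl
  obtain ⟨g₁₂, hg₁₂, himage₁₂⟩ := exists_distinctReps_union_eq_singleton hg₂
    (Set.disjoint_left.2 fun p h₁ h₂ => h₁.2.not_gt h₂.1)
    (distinctReps_sdiff_eq_singleton hg₁ (himage₁ ▸ himage₂ ▸ disjoint_trianglesIn.symm))
  rw [himage₁, himage₂] at himage₁₂
  obtain ⟨e, he, himage⟩ := exists_distinctReps_singleton (S := fun p => cliquesAt G p \ _)
    (hG.cliquesAt_sdiff_eq_singleton hxm hmy hxy hm)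
  rw [← himage₁₂] at he
  obtain ⟨g, hg, himageg⟩ := exists_distinctReps_union_eq_singleton hg₁₂
    (Set.disjoint_singleton_left.2 fun h => h.elim (fun h => h.2.false) fun h => h.1.false) he
  have hIoo : {m} ∪ (Set.Ioo x m ∪ Set.Ioo m y) = Set.Ioo x y := by
    ext p
    grind
  rw [himage₁₂, himage, hIoo, Set.singleton_union, ← hG.trianglesIn_eq_insert hxm hmy hxy hm]
    at himageg
  exact ⟨g, hIoo ▸ hg, himageg⟩

end IsMaximalNoncrossing
end Walk

section NumTuples

variable {α : Type*} {G : SimpleGraph α} {I J : Set α} {F F' : Set (Finset α)}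
  {Δ : Finset α} {i : α}

/-- The number of families `(Δ_p)`, `p ∈ I`, of pairwise distinct triangles that do not belong to
`F`, where `p` is a vertex of `Δ_p`. -/
noncomputable def numTuples (G : SimpleGraph α) (I : Set α) (F : Set (Finset α)) : ℕ :=
  (distinctReps (fun p => cliquesAt G p \ F) I).ncard

theorem numTuples_empty : numTuples G ∅ F = 1 := by
  rw [numTuples, distinctReps_empty, Set.ncard_singleton]

theorem numTuples_congr (h : ∀ p ∈ I, ∀ Δ ∈ cliquesAt G p, Δ ∈ F ↔ Δ ∈ F') :
    numTuples G I F = numTuples G I F' :=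
  congrArg Set.ncard (distinctReps_congr fun p hp =>
    Set.ext fun Δ => and_congr_right fun hΔ => not_congr (h p hp Δ hΔ))

theorem numTuples_insert (hi : i ∉ I) (hI : I.Finite)
    (hfin : ∀ p ∈ insert i I, (G.neighborSet p).Finite) :
    numTuples G (insert i I) ∅ = ∑ᶠ Δ ∈ cliquesAt G i, numTuples G I {Δ} := by
  simp only [numTuples, Set.sdiff_empty]
  exact ncard_distinctReps_insert hi hI fun p hp => finite_cliquesAt (hfin p hp)

theorem numTuples_insert_eq_add (hi : i ∉ I) (hI : I.Finite)
    (hfin : ∀ p ∈ insert i I, (G.neighborSet p).Finite) (hΔ : Δ ∈ cliquesAt G i) (hΔF : Δ ∉ F)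
    (hΔI : ∀ p ∈ I, p ∉ Δ) :
    numTuples G (insert i I) F = numTuples G (insert i I) (insert Δ F) + numTuples G I F := by
  rw [numTuples, ncard_distinctReps_insert_eq_add hi hI
    (fun p hp => (finite_cliquesAt (hfin p hp)).sdiff) ⟨hΔ, hΔF⟩ fun p hp h => hΔI p hp h.1.2]
  simp only [Set.sdiff_sdiff, Set.union_singleton]
  rfl

end NumTuples

section WalkNumber

variable {α : Type*} [LinearOrder α] {G : SimpleGraph α} {A m p q x y z : α} {I : Set α}
  {F : Set (Finset α)} {Δ : Finset α}

/-- The number of families of pairwise distinct triangles for the walk from `A` to `x`, whose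
interior vertices are the points between `A` and `x`, with the convention of `BCI` for the trivial
walk. -/
noncomputable def walkNumber (G : SimpleGraph α) (A x : α) : ℕ :=
  if x = A then 0 else numTuples G (Set.Ioo A x) ∅

theorem walkNumber_self : walkNumber G A A = 0 := if_pos rfl

theorem walkNumber_of_lt (h : A < x) : walkNumber G A x = numTuples G (Set.Ioo A x) ∅ :=
  if_neg h.ne'

theorem numTuples_Ioc_eq_add (hAx : A ≤ x) (hI : (Set.Ioo A x).Finite)
    (hfin : ∀ p ∈ Set.Ioc A x, (G.neighborSet p).Finite) (hΔ : Δ ∈ cliquesAt G x) (hΔF : Δ ∉ F)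
    (hΔA : ∀ p ∈ Set.Ioo A x, p ∉ Δ) (hF : ∀ p ∈ Set.Ioo A x, ∀ Δ ∈ cliquesAt G p, Δ ∉ F) :
    numTuples G (Set.Ioc A x) F = numTuples G (Set.Ioc A x) (insert Δ F) + walkNumber G A x := by
  obtain rfl | hlt := hAx.eq_or_lt
  · rw [Set.Ioc_self, numTuples_empty, numTuples_empty, walkNumber_self]
  · rw [← Set.Ioo_insert_right hlt] at hfin ⊢
    rw [numTuples_insert_eq_add (fun h => h.2.false) hI hfin hΔ hΔF hΔA, walkNumber_of_lt hlt,
      numTuples_congr (F := F) (F' := ∅) fun p hp Δ hΔ => iff_of_false (hF p hp Δ hΔ) id]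

namespace IsMaximalNoncrossing

variable (hG : IsMaximalNoncrossing G)
include hG

theorem numTuples_union_Ioo (hxy : G.Adj x y) (hfin : (Set.Ioo x y).Finite)
    (hI : Disjoint I (Set.Ioo x y)) (hF : Disjoint F (trianglesIn G x y)) :
    numTuples G (I ∪ Set.Ioo x y) F = numTuples G I (F ∪ trianglesIn G x y) := by
  obtain ⟨g, hg, himage⟩ := hG.exists_distinctReps_eq_singleton hxy hfin
  rw [← himage] at hF ⊢
  rw [numTuples, ncard_distinctReps_union (distinctReps_sdiff_eq_singleton hg hF) hI]
  simp only [Set.sdiff_sdiff]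
  rfl

theorem numTuples_eq_zero (hxy : G.Adj x y) (hfin : (Set.Ioo x y).Finite)
    (hI : Set.Ioo x y ⊆ I) (hF : ¬ Disjoint F (trianglesIn G x y)) : numTuples G I F = 0 := by
  obtain ⟨g, hg, himage⟩ := hG.exists_distinctReps_eq_singleton hxy hfin
  rw [numTuples, distinctReps_sdiff_eq_empty hg (himage ▸ hF) hI, Set.ncard_empty]

theorem numTuples_Ioo (hAx : A ≤ x) (hlt : x < y) (hxy : G.Adj x y) (hfin : (Set.Ioo x y).Finite)
    (hF : Disjoint F (trianglesIn G x y)) :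
    numTuples G (Set.Ioo A y) F = numTuples G (Set.Ioc A x) (F ∪ trianglesIn G x y) := by
  rw [← Set.Ioc_union_Ioo_eq_Ioo hAx hlt, hG.numTuples_union_Ioo hxy hfin ?_ hF]
  exact Set.disjoint_left.2 fun p hp hp' => hp.2.not_gt hp'.1

theorem numTuples_Ioo_eq_add (hAx : A ≤ x) (hlt : x < y) (hxy : G.Adj x y)
    (hI : (Set.Ioo A y).Finite) (hfin : ∀ p ∈ Set.Ioc A x, (G.neighborSet p).Finite)
    (hΔ : Δ ∈ cliquesAt G x) (hΔxy : Δ ∉ trianglesIn G x y) (hΔA : ∀ p ∈ Set.Ioo A x, p ∉ Δ) :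
    numTuples G (Set.Ioo A y) ∅ = numTuples G (Set.Ioo A y) {Δ} + walkNumber G A x := by
  have hxyfin : (Set.Ioo x y).Finite := hI.subset (Set.Ioo_subset_Ioo_left hAx)
  rw [hG.numTuples_Ioo hAx hlt hxy hxyfin (Set.empty_disjoint _),
    hG.numTuples_Ioo hAx hlt hxy hxyfin (Set.disjoint_singleton_left.2 hΔxy), Set.empty_union,
    Set.singleton_union, numTuples_Ioc_eq_add hAx (hI.subset (Set.Ioo_subset_Ioo_right hlt.le)) hfin
      hΔ hΔxy hΔA fun p hp Δ hΔ h => (h.2 p hΔ.2).1.not_gt hp.2]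

theorem walkNumber_eq_add (hAm : A ≤ m) (hmx : m < x) (hxy : x < y) (hadj_mx : G.Adj m x)
    (hadj_xy : G.Adj x y) (hadj_my : G.Adj m y) (hI : (Set.Ioo A y).Finite)
    (hfin : ∀ p ∈ Set.Ioc A m, (G.neighborSet p).Finite) :
    walkNumber G A x = walkNumber G A y + walkNumber G A m := by
  have hmy := hmx.trans hxy
  have hmxfin : (Set.Ioo m x).Finite := hI.subset (Set.Ioo_subset_Ioo hAm hxy.le)
  have hmyfin : (Set.Ioo m y).Finite := hI.subset (Set.Ioo_subset_Ioo_left hAm)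
  have hΔ : ({m, x, y} : Finset α) ∈ cliquesAt G m :=
    ⟨SimpleGraph.is3Clique_triple_iff.2 ⟨hadj_mx, hadj_my, hadj_xy⟩, by simp⟩
  rw [walkNumber_of_lt (hAm.trans_lt hmx), walkNumber_of_lt (hAm.trans_lt hmy),
    hG.numTuples_Ioo hAm hmx hadj_mx hmxfin (Set.empty_disjoint _),
    hG.numTuples_Ioo hAm hmy hadj_my hmyfin (Set.empty_disjoint _), Set.empty_union,
    Set.empty_union, hG.trianglesIn_eq_insert hadj_mx hadj_xy hadj_my ⟨hmx, hxy⟩,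
    numTuples_Ioc_eq_add hAm (hI.subset (Set.Ioo_subset_Ioo_right hmy.le)) hfin hΔ
      (fun h => (h.2 y (by simp)).2.not_gt hxy) ?_
      fun p hp Δ hΔ h => (h.2 p hΔ.2).1.not_gt hp.2]
  · refine congrArg (· + _) (numTuples_congr fun p hp Δ hΔ => ?_)
    have hright : Δ ∉ trianglesIn G x y := fun h => (h.2 p hΔ.2).1.not_gt (hp.2.trans_lt hmx)
    simp only [Set.mem_insert_iff, Set.mem_union, hright, or_false]
  · intro p hp
    have hpm := hp.2
    grind

theorem numTuples_Ioo_eq_zero (hAm : A ≤ m) (hmx : m < x) (hxy : x < y) (hadj_mx : G.Adj m x)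
    (hadj_xy : G.Adj x y) (hadj_my : G.Adj m y) (hI : (Set.Ioo A y).Finite) :
    numTuples G (Set.Ioo A y) {{m, x, y}} = 0 := by
  refine hG.numTuples_eq_zero hadj_my (hI.subset (Set.Ioo_subset_Ioo_left hAm))
    (Set.Ioo_subset_Ioo_left hAm) ?_
  rw [Set.disjoint_singleton_left, not_not,
    hG.trianglesIn_eq_insert hadj_mx hadj_xy hadj_my ⟨hmx, hxy⟩]
  exact Set.mem_insert _ _

theorem numTuples_Ioo_add_sub (hAx : A < x) (hI : (Set.Ioo A x).Finite)
    (hfin : ∀ p ∈ Set.Ioo A x, (G.neighborSet p).Finite) (hpq : (p, q) ∈ fan G x) :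
    (numTuples G (Set.Ioo A x) {{x, p, q}} : ℤ) +
        ((if p ∈ Set.Ico A x then -(walkNumber G A p : ℤ) else 0) -
          if q ∈ Set.Ico A x then -(walkNumber G A q : ℤ) else 0) = walkNumber G A x := by
  obtain ⟨hp, hq, hadj, hc⟩ := hpq
  have hfin' {r : α} (hr : r < x) : ∀ p ∈ Set.Ioc A r, (G.neighborSet p).Finite :=
    fun p hp => hfin p ⟨hp.1, hp.2.trans_lt hr⟩
  have hlt (hpA : p ∈ Set.Ico A x) : p < q ∧ q < x := by
    rcases hc with h | h | h
    exacts [absurd hpA.2 h.1.not_gt, h, absurd hpA.2 h.2.not_gt]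
  by_cases hqA : q ∈ Set.Ico A x
  · by_cases hpA : p ∈ Set.Ico A x
    · obtain ⟨hpq, hqx⟩ := hlt hpA
      have hadd := hG.walkNumber_eq_add hpA.1 hpq hqx hadj hq.symm hp.symm hI (hfin' hpA.2)
      have hzero := hG.numTuples_Ioo_eq_zero hpA.1 hpq hqx hadj hq.symm hp.symm hI
      have hrotate : ({x, p, q} : Finset α) = {p, q, x} := by grind
      rw [if_pos hpA, if_pos hqA, hadd, hrotate, hzero]
      push_cast
      ring
    · have hΔ : ({x, p, q} : Finset α) ∈ cliquesAt G q :=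
        ⟨SimpleGraph.is3Clique_triple_iff.2 ⟨hp, hq, hadj⟩, by simp⟩
      have hΔqx : ({x, p, q} : Finset α) ∉ trianglesIn G q x := fun h => by
        have hpqx := h.2 p (by simp)
        exact hpA ⟨hqA.1.trans hpqx.1, lt_of_le_of_ne hpqx.2 hp.ne'⟩
      have hadd := hG.numTuples_Ioo_eq_add hqA.1 hqA.2 hq.symm hI (hfin' hqA.2) hΔ hΔqx
        fun r hr => by grind
      rw [if_neg hpA, if_pos hqA, walkNumber_of_lt hAx, hadd]
      push_cast
      ring
  · have hpA : p ∉ Set.Ico A x := fun h =>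
      hqA ⟨h.1.trans (hlt h).1.le, (hlt h).2⟩
    rw [if_neg hqA, if_neg hpA, sub_zero, add_zero, walkNumber_of_lt hAx]
    refine congrArg _ (numTuples_congr fun r hr Δ hΔ => iff_of_false ?_ id)
    rintro rfl
    have hrx := hΔ.2
    grind

theorem walkNumber_add_walkNumber (hAy : A ≤ y) (hyx : y ⋖ x) (hxz : x ⋖ z)
    (hI : (Set.Ioo A x).Finite) (hfin : ∀ p ∈ Set.Ioc A x, (G.neighborSet p).Finite) :
    (walkNumber G A z + walkNumber G A y : ℤ) = (cliquesAt G x).ncard * walkNumber G A x := by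
  have hAx := hAy.trans_lt hyx.lt
  have hxfin := hfin x ⟨hAx, le_rfl⟩
  have hsum := hG.finsum_cliquesAt_add hxfin (circCovBy_of_covBy hyx) (circCovBy_of_covBy hxz)
    (w := fun Δ => (numTuples G (Set.Ioo A x) {Δ} : ℤ))
    (fun p => if p ∈ Set.Ico A x then -(walkNumber G A p : ℤ) else 0)
    (hG.numTuples_Ioo_add_sub hAx hI fun p hp => hfin p (Set.Ioo_subset_Ioc_self hp))
  have hz : walkNumber G A z = ∑ᶠ Δ ∈ cliquesAt G x, numTuples G (Set.Ioo A x) {Δ} := by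
    rw [walkNumber_of_lt (hAx.trans hxz.lt), hxz.Ioo_eq_Ioc A, ← Set.Ioo_insert_right hAx,
      numTuples_insert (fun h => h.2.false) hI (by rwa [Set.Ioo_insert_right hAx])]
  rw [hz, Nat.cast_finsum_mem (finite_cliquesAt hxfin)]
  simpa [hAy, hyx.lt, hxz.lt.not_gt] using hsum

end IsMaximalNoncrossing
end WalkNumber

/-! ### Continuant arrays and friezes -/

section ContinuantArray

variable {R : Type*} [CommRing R] {a : ℤ → R} {f g : ℤ → ℤ → R}

/-- The array of continuants of `a` in the half-plane `i ≤ j`: each row is the solution of the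
three-term recurrence with coefficients `a` starting with `0, 1` on the diagonal. The entries below
the diagonal are left free. -/
structure IsContinuantArray (a : ℤ → R) (f : ℤ → ℤ → R) : Prop where
  diag : ∀ i, f i i = 0
  one : ∀ i, f i (i + 1) = 1
  recurrence : ∀ {i j}, i < j → f i (j + 1) = a j * f i j - f i (j - 1)

theorem IsContinuantArray.apply_eq (hf : IsContinuantArray a f) (hg : IsContinuantArray a g)
    {i j : ℤ} (hij : i ≤ j) : f i j = g i j := by
  have hconsecutive : f i j = g i j ∧ f i (j + 1) = g i (j + 1) := by
    induction j, hij using Int.leInduction with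
    | base => exact ⟨by rw [hf.diag, hg.diag], by rw [hf.one, hg.one]⟩
    | succ j hij ih =>
      refine ⟨ih.2, ?_⟩
      rw [hf.recurrence (Int.lt_add_one_of_le hij), hg.recurrence (Int.lt_add_one_of_le hij),
        add_sub_cancel_right, ih.1, ih.2]
  exact hconsecutive.1

theorem exists_int_orbit {β : Type*} (e : ℤ → β ≃ β) (z₀ : β) :
    ∃ z : ℤ → β, z 0 = z₀ ∧ ∀ j, z (j + 1) = e j (z j) := by
  let z (j : ℤ) : β := j.inductionOn' 0 z₀ (fun j _ => e j) fun j _ => (e (j - 1)).symm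
  refine ⟨z, Int.inductionOn'_self, fun j => ?_⟩
  rcases le_or_gt 0 j with hj | hj
  · exact Int.inductionOn'_add_one hj
  · have hpred : z (j + 1 - 1) = (e (j + 1 - 1)).symm (z (j + 1)) :=
      Int.inductionOn'_sub_one (Int.add_one_le_of_lt hj)
    rw [add_sub_cancel_right] at hpred
    rw [hpred, Equiv.apply_symm_apply]

theorem exists_three_term_solution (a : ℤ → R) (x₀ x₁ : R) :
    ∃ x : ℤ → R, x 0 = x₀ ∧ x 1 = x₁ ∧ ∀ j, x (j + 1) = a j * x j - x (j - 1) := by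
  let e (j : ℤ) : R × R ≃ R × R :=
    { toFun := fun z => (z.2, a (j + 1) * z.2 - z.1)
      invFun := fun z => (a (j + 1) * z.1 - z.2, z.1)
      left_inv := fun z => by simp
      right_inv := fun z => by simp }
  obtain ⟨z, hz₀, hz⟩ := exists_int_orbit e (x₀, x₁)
  have hfst (j : ℤ) : (z (j + 1)).1 = (z j).2 := congrArg Prod.fst (hz j)
  have hsnd (j : ℤ) : (z (j + 1)).2 = a (j + 1) * (z j).2 - (z j).1 := congrArg Prod.snd (hz j)
  refine ⟨fun j => (z j).1, congrArg Prod.fst hz₀, (hfst 0).trans (congrArg Prod.snd hz₀),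
    fun j => ?_⟩
  obtain ⟨k, rfl⟩ : ∃ k, j = k + 1 := ⟨j - 1, (sub_add_cancel j 1).symm⟩
  simp only [hfst, hsnd, add_sub_cancel_right]

theorem wronskian_eq_one {u w : ℤ → R} (hu : ∀ j, u (j + 1) = a j * u j - u (j - 1))
    (hw : ∀ j, w (j + 1) = a j * w j - w (j - 1)) (h₀ : u 0 * w 1 - w 0 * u 1 = 1) (j : ℤ) :
    u j * w (j + 1) - w j * u (j + 1) = 1 := by
  have hstep (j : ℤ) : u (j - 1) * w j - w (j - 1) * u j = u j * w (j + 1) - w j * u (j + 1) := by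
    rw [hu, hw]
    ring
  induction j with
  | zero => simpa using h₀
  | succ n ih => rw [← ih, ← hstep, add_sub_cancel_right]
  | pred n ih => rw [sub_add_cancel, hstep, ih]

/-- The array is made of the `2 × 2` minors of two independent solutions of the recurrence. -/
theorem exists_isContinuantArray (a : ℤ → R) : ∃ t : ℤ → ℤ → R, IsContinuantArray a t ∧
    (∀ i j, t i j = -t j i) ∧ (∀ i, t (i - 1) (i + 1) = a i) ∧
    ∀ i j, t i j * t (i + 1) (j + 1) - t i (j + 1) * t (i + 1) j = 1 := by
  obtain ⟨u, hu₀, hu₁, hu⟩ := exists_three_term_solution a 1 0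
  obtain ⟨w, hw₀, hw₁, hw⟩ := exists_three_term_solution a 0 1
  have hone := wronskian_eq_one hu hw (by simp [hu₀, hu₁, hw₀, hw₁])
  refine ⟨fun i j => u i * w j - w i * u j,
    ⟨fun i => by ring, hone, fun {i j} _ => ?_⟩, fun i j => by ring, fun i => ?_, fun i j => ?_⟩
  · rw [hu, hw]
    ring
  · have hone' := hone (i - 1)
    rw [sub_add_cancel] at hone'
    simp only [hu i, hw i]
    linear_combination a i * hone'
  · linear_combination (u j * w (j + 1) - w j * u (j + 1)) * hone i + hone j

end ContinuantArray

theorem IsInfiniteFrieze.isContinuantArray {t : ℤ → ℤ → ℤ} (ht : IsInfiniteFrieze t) :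
    IsContinuantArray (quiddity t) t := by
  refine ⟨ht.diag, ht.one, fun {i j} hij => ?_⟩
  induction i, Int.le_sub_one_of_lt hij using Int.leInductionDown with
  | base =>
    have hone := ht.one (j - 1)
    rw [sub_add_cancel] at hone
    rw [quiddity, ht.diag, hone, mul_one, sub_zero]
  | pred i hi ih =>
    have hij : i < j := Int.lt_of_le_sub_one hi
    have hleft := ht.unimodular (i - 1) (j - 1)
    have hright := ht.unimodular (i - 1) j
    rw [sub_add_cancel] at hleft hright
    rw [sub_add_cancel] at hleft
    rw [ih hij] at hright
    refine mul_left_cancel₀ (zero_lt_one.trans_le (ht.pos i j hij)).ne' ?_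
    linear_combination hleft - hright

theorem IsInfiniteFrieze.apply_eq {t : ℤ → ℤ → ℤ} (ht : IsInfiniteFrieze t) {a : ℤ → ℤ}
    (hq : ∀ i, quiddity t i = a i) {f : ℤ → ℤ → ℤ} (hf : IsContinuantArray a f) {i j : ℤ}
    (hij : i ≤ j) : t i j = f i j := by
  obtain rfl : quiddity t = a := funext hq
  exact ht.isContinuantArray.apply_eq hf hij

theorem IsContinuantArray.existsUnique_frieze {a : ℤ → ℤ} {f : ℤ → ℤ → ℤ}
    (hf : IsContinuantArray a f) (hpos : ∀ i j, i < j → 1 ≤ f i j) :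
    ∃! t : ℤ → ℤ → ℤ, IsInfiniteFrieze t ∧ ∀ i, quiddity t i = a i := by
  obtain ⟨t, ht, hanti, hquid, huni⟩ := exists_isContinuantArray a
  refine ⟨t, ⟨⟨ht.diag, fun i j hij => ?_, ht.one, hanti, huni⟩, hquid⟩, ?_⟩
  · rw [ht.apply_eq hf hij.le]
    exact hpos i j hij
  · rintro s ⟨hs, hq⟩
    ext i j
    rcases le_total i j with hij | hji
    · exact hs.apply_eq hq ht hij
    · rw [hs.antisymm, hanti, hs.apply_eq hq ht hji]

/-! ### Triangulations of the strip -/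

section Strip

variable {M₂ : Set ℤ} {T : Set (Arc M₂)} {p q : MarkedPoint M₂} {i j : ℤ}

theorem exists_arc_of_adj (hpq : (edgeGraph T).Adj p q) (hlt : p < q) (hcov : ¬ p ⋖ q) :
    ∃ α ∈ T, α.fst = p ∧ α.snd = q := by
  obtain ⟨α, hα, h | ⟨rfl, rfl⟩⟩ | h | h := hpq
  exacts [⟨α, hα, h⟩, absurd hlt α.lt.asymm, absurd h hcov, absurd hlt h.lt.asymm]

theorem not_adj_of_interlacing {a b c d : MarkedPoint M₂} (hT : IsTriangulation T)
    (hab : (edgeGraph T).Adj a b) (hac : a < c) (hcb : c < b) (hbd : b < d) :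
    ¬ (edgeGraph T).Adj c d := by
  intro hcd
  obtain ⟨α, hα, rfl, rfl⟩ := exists_arc_of_adj hab (hac.trans hcb) fun h => h.2 hac hcb
  obtain ⟨β, hβ, rfl, rfl⟩ := exists_arc_of_adj hcd (hcb.trans hbd) fun h => h.2 hcb hbd
  exact hT.prop hα hβ (by rintro rfl; exact hac.false) (Or.inl ⟨hac, hcb, hbd⟩)

theorem mem_of_forall_not_crosses (hT : IsTriangulation T) {α : Arc M₂}
    (hα : ∀ β ∈ T, ¬ α.Crosses β) : α ∈ T :=
  hT.le_of_ge
    (hT.prop.insert fun β hβ _ => ⟨hα β hβ, fun hβα => hα β hβ hβα.symm⟩)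
    (Set.subset_insert α T) (Set.mem_insert α T)

theorem isMaximalNoncrossing_edgeGraph (hT : IsTriangulation T) :
    IsMaximalNoncrossing (edgeGraph T) where
  noncrossing a b c d hab hcd hacb hbda := by
    have hba := hab.symm
    have hdc := hcd.symm
    rcases hacb with ⟨h₁, h₂⟩ | ⟨h₁, h₂⟩ | ⟨h₁, h₂⟩ <;>
      rcases hbda with ⟨h₃, h₄⟩ | ⟨h₃, h₄⟩ | ⟨h₃, h₄⟩ <;>
      grind [not_adj_of_interlacing hT]
  maximal p q hpq h := by
    wlog hlt : p < q generalizing p q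
    · exact (this q p hpq.symm (fun _ _ hcd hc hd => h hcd.symm hd hc)
        (lt_of_le_of_ne (not_lt.1 hlt) hpq.symm)).symm
    by_cases hcov : p ⋖ q
    · exact Or.inr (Or.inl hcov)
    refine Or.inl ⟨⟨p, q, hlt, hcov⟩, mem_of_forall_not_crosses hT fun β hβ => ?_,
      Or.inl ⟨rfl, rfl⟩⟩
    have hadj : (edgeGraph T).Adj β.fst β.snd := Or.inl ⟨β, hβ, Or.inl ⟨rfl, rfl⟩⟩
    rintro (⟨hp, hβq, hq⟩ | ⟨hβp, hp, hq⟩)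
    · exact h hadj (Or.inl ⟨hp, hβq⟩) (Or.inr (Or.inr ⟨hlt, hq⟩))
    · exact h hadj.symm (Or.inl ⟨hp, hq⟩) (Or.inr (Or.inl ⟨hβp, hlt⟩))

theorem lower_lt_lower : (lower i : MarkedPoint M₂) < lower j ↔ i < j := Sum.Lex.inl_lt_inl_iff

theorem exists_lower_eq_of_lt (h : p < lower j) : ∃ i, lower i = p := by
  obtain ⟨i | u, rfl⟩ := toLex.surjective p
  exacts [⟨i, rfl⟩, absurd h Sum.Lex.not_inr_lt_inl]

theorem lower_covBy (i : ℤ) : (lower i : MarkedPoint M₂) ⋖ lower (i + 1) := by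
  refine ⟨lower_lt_lower.2 (lt_add_one i), fun p hip hp => ?_⟩
  obtain ⟨k, rfl⟩ := exists_lower_eq_of_lt hp
  exact (Int.lt_iff_add_one_le.1 (lower_lt_lower.1 hip)).not_gt (lower_lt_lower.1 hp)

theorem lower_pred_covBy (i : ℤ) : (lower (i - 1) : MarkedPoint M₂) ⋖ lower i := by
  simpa only [sub_add_cancel] using lower_covBy (M₂ := M₂) (i - 1)

theorem adj_lower_succ (i : ℤ) : (edgeGraph T).Adj (lower i) (lower (i + 1)) :=
  Or.inr (Or.inl (lower_covBy i))

theorem finite_neighborSet_lower (hadm : IsAdmissible T) (i : ℤ) :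
    ((edgeGraph T).neighborSet (lower i)).Finite := by
  refine (((hadm i).image Arc.fst).union (((hadm i).image Arc.snd).union
    (Set.toFinite {lower (i + 1), lower (i - 1)}))).subset ?_
  rintro q (⟨α, hα, ⟨hfst, hsnd⟩ | ⟨hfst, hsnd⟩⟩ | h | h)
  · exact Or.inr (Or.inl ⟨α, ⟨hα, Or.inl hfst⟩, hsnd⟩)
  · exact Or.inl ⟨α, ⟨hα, Or.inr hsnd⟩, hfst⟩
  · exact Or.inr (Or.inr (Or.inl (h.unique_right (lower_covBy i))))
  · exact Or.inr (Or.inr (Or.inr (h.unique_left (lower_pred_covBy i))))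

theorem isLabelled_lower (hT : IsTriangulation T) (hadm : IsAdmissible T) (hij : i ≤ j) :
    IsLabelled T (lower i) (lower j) := by
  have hconsecutive : IsLabelled T (lower i) (lower j) ∧
      IsLabelled T (lower i) (lower (j + 1)) := by
    induction j, hij using Int.leInduction with
    | base => exact ⟨⟨0, ccLabel_self⟩, 1, ccLabel_of_adj (adj_lower_succ i)⟩
    | succ j _ ih =>
      exact ⟨ih.2, ih.2.of_adj (isMaximalNoncrossing_edgeGraph hT)
        (finite_neighborSet_lower hadm (j + 1)) (circCovBy_of_covBy (lower_covBy j)) ih.1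
        (adj_lower_succ (j + 1))⟩
  exact hconsecutive.1

theorem isContinuantArray_label (hT : IsTriangulation T) (hadm : IsAdmissible T) :
    IsContinuantArray (fun i => (numTriangles T i : ℤ))
      fun i j => (label T (lower i) (lower j) : ℤ) := by
  have hG := isMaximalNoncrossing_edgeGraph hT
  refine ⟨fun i => by exact_mod_cast ccLabel_self.label_eq hG,
    fun i => by exact_mod_cast (ccLabel_of_adj (adj_lower_succ i)).label_eq hG,
    fun {i j} hij => eq_sub_of_add_eq ?_⟩
  exact label_add_label hG (finite_neighborSet_lower hadm j)
    (circCovBy_of_covBy (lower_pred_covBy j)) (circCovBy_of_covBy (lower_covBy j))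
    (lower_lt_lower.2 hij).ne' (isLabelled_lower hT hadm hij.le)
    (isLabelled_lower hT hadm (Int.le_sub_one_of_lt hij))

theorem one_le_label_lower (hT : IsTriangulation T) (hadm : IsAdmissible T) (hij : i < j) :
    1 ≤ label T (lower i) (lower j) :=
  (isLabelled_lower hT hadm hij.le).ccLabel.pos (isMaximalNoncrossing_edgeGraph hT)
    (lower_lt_lower.2 hij).ne'

theorem range_lower_add (i j : ℤ) :
    Set.range (fun k : Fin (j - i - 1).toNat => (lower (i + 1 + (k : ℤ)) : MarkedPoint M₂)) =
      Set.Ioo (lower i) (lower j) := by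
  ext p
  constructor
  · rintro ⟨k, rfl⟩
    exact ⟨lower_lt_lower.2 (by omega), lower_lt_lower.2 (by omega)⟩
  · rintro ⟨hip, hpj⟩
    obtain ⟨k, rfl⟩ := exists_lower_eq_of_lt hpj
    have hik := lower_lt_lower.1 hip
    have hkj := lower_lt_lower.1 hpj
    exact ⟨⟨(k - i - 1).toNat, by omega⟩, congrArg lower (by dsimp only; omega)⟩

theorem BCI_eq_walkNumber (hij : i ≤ j) :
    BCI T i j = walkNumber (edgeGraph T) (lower i) (lower j) := by
  obtain rfl | hlt := hij.eq_or_lt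
  · rw [BCI, if_pos rfl, walkNumber_self]
  have hinj : Function.Injective
      fun k : Fin (j - i - 1).toNat => (lower (i + 1 + (k : ℤ)) : MarkedPoint M₂) :=
    fun k l hkl => by
    have hkl : i + 1 + (k : ℤ) = i + 1 + l := Sum.inl_injective (toLex.injective hkl)
    omega
  rw [BCI, if_neg hlt.ne, walkNumber_of_lt (lower_lt_lower.2 hlt), numTuples, ← range_lower_add]
  simp only [Set.sdiff_empty]
  have hbij := bijOn_comp_distinctReps (S := cliquesAt (edgeGraph T)) hinj
  exact (congrArg Set.ncard hbij.image_eq).symm.trans hbij.injOn.ncard_image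

theorem isContinuantArray_BCI (hT : IsTriangulation T) (hadm : IsAdmissible T) :
    IsContinuantArray (fun i => (numTriangles T i : ℤ)) fun i j => (BCI T i j : ℤ) := by
  refine ⟨fun i => by simp [BCI], fun i => ?_, fun {i j} hij => eq_sub_of_add_eq ?_⟩
  · rw [BCI_eq_walkNumber (lt_add_one i).le, walkNumber_of_lt (lower_covBy i).lt,
      (lower_covBy i).Ioo_eq, numTuples_empty, Nat.cast_one]
  · rw [BCI_eq_walkNumber (by omega), BCI_eq_walkNumber (by omega), BCI_eq_walkNumber (by omega)]
    refine (isMaximalNoncrossing_edgeGraph hT).walkNumber_add_walkNumber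
      ((lower_pred_covBy j).le_of_lt (lower_lt_lower.2 hij)) (lower_pred_covBy j) (lower_covBy j)
      ?_ fun p hp => ?_
    · rw [← range_lower_add]
      exact Set.finite_range _
    · obtain ⟨k, rfl⟩ := exists_lower_eq_of_lt (hp.2.trans_lt (lower_covBy j).lt)
      exact finite_neighborSet_lower hadm k

end Strip

end Strip

open Strip in
theorem proposition2p8_general (M₂ : Set ℤ) (T : Set (Arc M₂)) (hT : IsTriangulation T)
    (hadm : IsAdmissible T) :
    (∃! t : ℤ → ℤ → ℤ, IsPhi T t) ∧
      ∀ t : ℤ → ℤ → ℤ, IsPhi T t → ∀ i j : ℤ, i ≤ j →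
        CCEq T (lower i) (lower j) (t i j) ∧ t i j = (BCI T i j : ℤ) := by
  have hlabel := isContinuantArray_label hT hadm
  refine ⟨hlabel.existsUnique_frieze fun i j hij =>
    Int.ofNat_le.2 (one_le_label_lower hT hadm hij), ?_⟩
  rintro t ⟨ht, hquid⟩ i j hij
  refine ⟨?_, ht.apply_eq hquid (isContinuantArray_BCI hT hadm) hij⟩
  rw [ht.apply_eq hquid hlabel hij]
  exact (isLabelled_lower hT hadm hij).ccEq (isMaximalNoncrossing_edgeGraph hT)

theorem proposition2p8 (M₂ : Set ℤ) (T : Set (Strip.Arc M₂))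
    (hT : Strip.IsTriangulation T) (hadm : Strip.IsAdmissible T)
    (hspecial : ∀ u : M₂, ¬ Strip.IsSpecial T (Strip.upper u)) :
    (∃! t : ℤ → ℤ → ℤ, Strip.IsPhi T t) ∧
      ∀ t : ℤ → ℤ → ℤ, Strip.IsPhi T t →
        ∀ i j : ℤ, i ≤ j →
          Strip.CCEq T (Strip.lower i) (Strip.lower j) (t i j) ∧
            t i j = (Strip.BCI T i j : ℤ) :=
  proposition2p8_general M₂ T hT hadm
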